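/- Let $n\ge 3$ and let $\pi$ be the permutation with top row $1,2,\dots,n$ and bottom row $n,3,2,5,4,\dots,n-1,n-2,1$ if $n$ is even, and $n,3,2,5,4,\dots,n-2,n-3,n-1,1$ if $n$ is odd. In right Rauzy induction, a step of type $0$ is one in which the last interval of the top row is longer than the last interval of the bottom row (the latter is then removed from the end of the bottom row and inserted there directly after the former), and a step of type $1$ is one in which it is shorter (with the roles of the rows exchanged). For integers $a,c>0$ consider the closed Rauzy path at $\pi$ $$\gamma_{a,c}=0\,\dot\gamma_{n-2,a}\dot\gamma_{n-4,a}\cdots\dot\gamma_{2,a}\,1^{c(n-1)}\ (n \text{ even}),\qquad \gamma_{a,c}=0\,10\,\dot\gamma_{n-3,a}\dot\gamma_{n-5,a}\cdots\dot\gamma_{2,a}\,1^{c(n-1)}\ (n\text{ odd}),$$ where $\dot\gamma_{j,a}=1^{n-1-j}\,0^a\,1\,0^2$, and let $\Theta_{c,a}$ be its transition matrix, which expresses the lengths before the path through the lengths after it (the product, in the order of the path, of the matrices $1+E_{w,l}$, where in each step $w$ is the longer and $l$ the shorter of the two last intervals). Let $p\ge n+1$ be an integer, let $(a_m)_{m\ge1}$,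 $(c_m)_{m\ge1}$ be sequences of positive integers with $c_{m+1}=pa_m=p^2c_m$ for all $m\geq 1$, and put $\Theta_m=\Theta_{c_m,a_m}$. Let $T$ be an interval exchange transformation of $n$ intervals of $[0,1)$ with permutation $\pi$ whose infinite Rauzy path is $\gamma_{a_1,c_1}\gamma_{a_2,c_2}\cdots$. For $k\ge0$ let $I^{(k)}$ be the interval on which the exchange induced by the first $k$ closed paths lives, let $I^{(k)}_1,\dots,I^{(k)}_n$ be its exchanged subintervals, and let $b_{k,i}=|\Theta_1\cdots\Theta_k e_i|$ (the sum of the entries of the vector), the return time of $I^{(k)}_i$ to $I^{(k)}$. For $j\in\{3,5,\dots,2\lfloor n/2\rfloor-1,n\}$ let $\lambda_j$ be the $T$-invariant Borel probability measure on $[0,1)$ with $$\big(\lambda_j(I^{(0)}_1),\dots,\lambda_j(I^{(0)}_n)\big)=\lim_{m\to\infty}\frac{\Theta_1\cdots\Theta_m e_j}{|\Theta_1\cdots\Theta_m e_j|}.$$ Let $d_{\lambda_j}(x,y)$ be the $\lambda_j$-measure of the segment between $x$ and $y$, and let $\dim_H(\lambda_i,d_{\lambda_j})$ be the infimum of the Hausdorff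 dimensions, with respect to $d_{\lambda_j}$, of the Borel subsets of $[0,1)$ of full $\lambda_i$-measure. Then for all distinct $i,j\in\{3,5,\dots,2\lfloor n/2\rfloor-1,n\}$ $$\liminf_{k\to\infty}\,\log_{\lambda_j(I_i^{(k)})}\lambda_i(I_i^{(k)})\ \le\ \dim_H(\lambda_i,d_{\lambda_j})\ \le\ \liminf_{k\to\infty}\,\log_{\lambda_j(I_i^{(k)})}b_{k,i}^{-1}.$$ -/

import Mathlib

open MeasureTheory Filter Topology
open scoped ENNReal

noncomputable section

namespace FickIET

/-! ### Interval exchange transformations and right Rauzy induction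

The intervals of an exchange of `n` intervals carry labels in `Fin n`; the label `t : Fin n` stands
for the interval with number `t + 1` in the usual numbering `1, …, n`. -/

/-- The two kinds of steps of right Rauzy induction. In a step of type `zero` the last interval of
the top row is longer than the last interval of the bottom row; in a step of type `one` it is
shorter. -/
inductive RauzyType
  | zero
  | one

/-- The combinatorial data of an interval exchange: the labels in their order before the exchange
(`top`) and in their order after the exchange (`bot`). -/
structure RauzyPair (n : ℕ) where
  top : List (Fin n)
  bot : List (Fin n)

/-- The list `L` with `l` inserted directly after `w`. -/
def insertAfter {n : ℕ} (w l : Fin n) (L : List (Fin n)) : List (Fin n) :=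
  L.flatMap fun x => if x = w then [w, l] else [x]

namespace RauzyPair

variable {n : ℕ} [NeZero n]

/-- The longer one of the two rightmost intervals in a step of the given type. -/
def winner (π : RauzyPair n) : RauzyType → Fin n
  | .zero => π.top.getLastD 0
  | .one => π.bot.getLastD 0

/-- The shorter one of the two rightmost intervals in a step of the given type. -/
def loser (π : RauzyPair n) : RauzyType → Fin n
  | .zero => π.bot.getLastD 0
  | .one => π.top.getLastD 0

/-- The action of a Rauzy step on the combinatorial data: the loser is removed from the end of its
row and inserted directly after the winner in that row. -/
def move (π : RauzyPair n) : RauzyType → RauzyPair n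
  | .zero => ⟨π.top, insertAfter (π.winner .zero) (π.loser .zero) π.bot.dropLast⟩
  | .one => ⟨insertAfter (π.winner .one) (π.loser .one) π.top.dropLast, π.bot⟩

/-- The matrix of a Rauzy path: the product, in the order of the path, of the elementary matrices
`1 + E_{winner, loser}`. It expresses the old lengths through the new ones: a step replaces the
length of the winner by its difference with the length of the loser. -/
def pathMatrix (π : RauzyPair n) : List RauzyType → Matrix (Fin n) (Fin n) ℕ
  | [] => 1
  | e :: w => (1 + Matrix.single (π.winner e) (π.loser e) 1) * pathMatrix (π.move e) w

end RauzyPair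

/-- The total length of the intervals that stand before `t` in the row `L`. -/
def offset {n : ℕ} (L : List (Fin n)) (len : Fin n → ℝ) (t : Fin n) : ℝ :=
  ((L.takeWhile fun s => s ≠ t).map len).sum

/-- An interval exchange: combinatorial data together with the lengths of the intervals. -/
structure IETData (n : ℕ) where
  pair : RauzyPair n
  len : Fin n → ℝ

namespace IETData

variable {n : ℕ}

/-- The interval with label `t`. -/
def interval (S : IETData n) (t : Fin n) : Set ℝ :=
  Set.Ico (offset S.pair.top S.len t) (offset S.pair.top S.len t + S.len t)

/-- The transformation itself: it translates each interval from its place in the top row to its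
place in the bottom row (and is the identity outside the union of the intervals). -/
def toFun (S : IETData n) (x : ℝ) : ℝ :=
  x + ∑ t, (S.interval t).indicator
    (fun _ => offset S.pair.bot S.len t - offset S.pair.top S.len t) x

variable [NeZero n]

/-- The Rauzy step that the interval exchange admits is of type `e`: the winner of that type is
strictly longer than the loser. -/
def HasType (S : IETData n) (e : RauzyType) : Prop :=
  S.len (S.pair.loser e) < S.len (S.pair.winner e)

/-- The interval exchange after a Rauzy step of type `e`. -/
def step (S : IETData n) (e : RauzyType) : IETData n where
  pair := S.pair.move e
  len := Function.update S.len (S.pair.winner e)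
    (S.len (S.pair.winner e) - S.len (S.pair.loser e))

/-- The interval exchange after the Rauzy steps of a path. -/
def run (S : IETData n) : List RauzyType → IETData n
  | [] => S
  | e :: w => (S.step e).run w

/-- The first steps of Rauzy induction on `S` are those of the given path. -/
def Follows (S : IETData n) : List RauzyType → Prop
  | [] => True
  | e :: w => S.HasType e ∧ (S.step e).Follows w

end IETData

/-! ### The closed Rauzy path -/

/-- The permutation: in the bottom row, the first and the last label are exchanged, and the labels
`2, …, n - 1` are exchanged with their neighbours, `2 ↔ 3`, `4 ↔ 5`, … (for odd `n` the label
`n - 1` is left without a partner and stays). This is written here for labels starting at `0`. -/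
def basePair (n : ℕ) [NeZero n] : RauzyPair n where
  top := List.finRange n
  bot := (List.finRange n).map fun q =>
    if q.val = 0 then Fin.ofNat n (n - 1)
    else if q.val = n - 1 then 0
    else if q.val % 2 = 1 then (if q.val + 1 ≤ n - 2 then Fin.ofNat n (q.val + 1) else q)
    else Fin.ofNat n (q.val - 1)

/-- The path `1^{n-1-j} 0^a 1 0^2`. -/
def dotPath (n j a : ℕ) : List RauzyType :=
  List.replicate (n - 1 - j) .one ++ List.replicate a .zero ++ [.one, .zero, .zero]

/-- The closed path `0 γ̇_{n-2,a} γ̇_{n-4,a} ⋯ γ̇_{2,a} 1^{c(n-1)}` for even `n`, and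
`0 10 γ̇_{n-3,a} γ̇_{n-5,a} ⋯ γ̇_{2,a} 1^{c(n-1)}` for odd `n`, where `γ̇_{j,a}` is
`dotPath n j a`. -/
def cycle (n a c : ℕ) : List RauzyType :=
  [.zero] ++ (if n % 2 = 1 then [.one, .zero] else []) ++
    (List.range (n / 2 - 1)).reverse.flatMap (fun r => dotPath n (2 * (r + 1)) a) ++
    List.replicate (c * (n - 1)) .one

variable {n : ℕ} [NeZero n]

/-- The transition matrix `Θ_{c,a}` of the closed path. -/
def Theta (n : ℕ) [NeZero n] (a c : ℕ) : Matrix (Fin n) (Fin n) ℕ :=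
  (basePair n).pathMatrix (cycle n a c)

/-- The product `Θ_1 ⋯ Θ_k`, where `Θ_m` has the parameters `a m`, `c m` (`m = 1, 2, …`). -/
def thetaProd (n : ℕ) [NeZero n] (a c : ℕ → ℕ) : ℕ → Matrix (Fin n) (Fin n) ℕ
  | 0 => 1
  | k + 1 => thetaProd n a c k * Theta n (a (k + 1)) (c (k + 1))

/-- The return time `b_{k,i} = |Θ_1 ⋯ Θ_k e_i|`. -/
def returnTime (a c : ℕ → ℕ) (k : ℕ) (i : Fin n) : ℕ :=
  ∑ t, thetaProd n a c k t i

/-- The normalized vector `Θ_1 ⋯ Θ_m e_j / |Θ_1 ⋯ Θ_m e_j|`. (Normalizing after each of the `m`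
multiplications gives the same vector.) -/
def normalizedColumn (a c : ℕ → ℕ) (m : ℕ) (j : Fin n) : Fin n → ℝ :=
  fun t => (thetaProd n a c m t j : ℝ) / (returnTime a c m j : ℝ)

/-- The interval exchange induced by `S` after `k` closed paths, with the parameters
`a 1, c 1, …, a k, c k`. -/
def stage (S : IETData n) (a c : ℕ → ℕ) : ℕ → IETData n
  | 0 => S
  | k + 1 => (stage S a c k).run (cycle n (a (k + 1)) (c (k + 1)))

/-- `S` is an exchange of `n` intervals of `[0, 1)` that is generated by the sequence of
parameters: it has the permutation `basePair n`, and its infinite Rauzy path is the concatenation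
of the closed paths with the parameters `a k`, `c k`, for `k = 1, 2, …`. -/
structure IsGeneratedBy (S : IETData n) (a c : ℕ → ℕ) : Prop where
  len_pos : ∀ t, 0 < S.len t
  len_sum : ∑ t, S.len t = 1
  pair_eq : S.pair = basePair n
  follows : ∀ k, (stage S a c k).Follows (cycle n (a (k + 1)) (c (k + 1)))

/-- `I_i^{(k)}`, the subinterval with label `i` of the interval `I^{(k)}` on which the exchange
`stage S a c k` lives. -/
def subinterval (S : IETData n) (a c : ℕ → ℕ) (k : ℕ) (i : Fin n) : Set ℝ :=
  (stage S a c k).interval i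

/-- `μ` is the measure `λ_j`: the probability measure on `[0, 1)`, invariant under the interval
exchange `S`, whose vector of values on the `n` exchanged intervals is the limit, as `m → ∞`, of the
normalized vectors `Θ_1 ⋯ Θ_m e_j / |Θ_1 ⋯ Θ_m e_j|`. -/
structure IsLimitMeasure (S : IETData n) (a c : ℕ → ℕ) (j : Fin n) (μ : Measure ℝ) : Prop where
  prob : IsProbabilityMeasure μ
  carrier : μ (Set.Ico 0 1)ᶜ = 0
  invariant : MeasurePreserving S.toFun μ μ
  limit : Tendsto (fun m => normalizedColumn a c m j) atTop
    (𝓝 fun t => μ.real (S.interval t))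

/-- The index set `{3, 5, …, 2⌊n/2⌋ - 1, n}`, in terms of labels that start at `0`. -/
def IsIndex (i : Fin n) : Prop :=
  ((i.val + 1) % 2 = 1 ∧ 3 ≤ i.val + 1 ∧ i.val + 1 ≤ 2 * (n / 2) - 1) ∨ i.val + 1 = n

/-! ### Hausdorff dimension

The Hausdorff measures and dimensions of a set `X` with a distance function `d`. -/

section Hausdorff

variable {E : Type*}

/-- The diameter of a set with respect to `d`. -/
def diamOf (d : E → E → ℝ≥0∞) (U : Set E) : ℝ≥0∞ :=
  ⨆ x ∈ U, ⨆ y ∈ U, d x y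

/-- `H_{s,ε}(A)`: the infimum of `∑ (diam U_m)^s` over the countable covers of `A` by subsets `U_m`
of `X` of diameter less than `ε`. -/
def hausdorffPre (X : Set E) (d : E → E → ℝ≥0∞) (s : ℝ) (ε : ℝ≥0∞) (A : Set E) : ℝ≥0∞ :=
  ⨅ (U : ℕ → Set E) (_ : ∀ m, U m ⊆ X) (_ : A ⊆ ⋃ m, U m) (_ : ∀ m, diamOf d (U m) < ε),
    ∑' m, diamOf d (U m) ^ s

/-- The Hausdorff `s`-measure of `A`. -/
def hausdorffMeas (X : Set E) (d : E → E → ℝ≥0∞) (s : ℝ) (A : Set E) : ℝ≥0∞ :=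
  ⨆ (ε : ℝ≥0∞) (_ : 0 < ε), hausdorffPre X d s ε A

/-- The Hausdorff dimension of `A`: the infimum of the `s > 0` for which the Hausdorff `s`-measure
of `A` vanishes. -/
def hausdorffDim (X : Set E) (d : E → E → ℝ≥0∞) (A : Set E) : EReal :=
  ⨅ (s : ℝ) (_ : 0 < s) (_ : hausdorffMeas X d s A = 0), (s : EReal)

/-- The Hausdorff dimension of a measure `μ` on `X`: the infimum of the Hausdorff dimensions of the
measurable subsets of `X` of full measure. -/
def measureDim [MeasurableSpace E] (X : Set E) (d : E → E → ℝ≥0∞) (μ : Measure E) : EReal :=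
  ⨅ (A : Set E) (_ : A ⊆ X) (_ : MeasurableSet A) (_ : μ (X \ A) = 0), hausdorffDim X d A

end Hausdorff

/-- The metric `d_μ` on the interval: the `μ`-measure of the segment between two points. -/
def measureDist (μ : Measure ℝ) (x y : ℝ) : ℝ≥0∞ :=
  μ (Set.uIcc x y)

end FickIET

end

noncomputable section

namespace FickIET

/-! ### The combinatorics of the closed path -/

/-! Over the induced interval `I_i^{(k)}` stands a tower: `b_{k,i}` disjoint translates of it inside
`[0,1)`, all of the same measure for each invariant measure. Both dimension bounds come from the
fact that `λ_i` lives almost entirely on the `i`-th tower, up to an error that is summable in `k`.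

Lower bound (`le_measureDim_of_towers`). By summability, the intersection of all towers from some
stage on has positive `λ_i`-measure. A set of `d_{λ_j}`-diameter below `λ_j(I_i^{(k)})` meets at
most two floors of the `k`-th tower, so its part in that intersection has `λ_i`-measure at most `2
λ_i(I_i^{(k)})`. The mass distribution principle then applies, provided that consecutive scales
`λ_j(I_i^{(k)})` and `λ_j(I_i^{(k+1)})` are comparable on the logarithmic scale.

Upper bound (`measureDim_le_of_towers`). The points in infinitely many towers of a sparse
subsequence have full `λ_i`-measure, and the floors cover them: `b_{k,i}` sets of `d_{λ_j}`-diameter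
at most `λ_j(I_i^{(k)})`.

Two facts about the matrices are needed; both rest on `track_cycle`, which computes the action of
`Θ` on a row of tower heights. Concentration: for an index `i`, nearly all of `b_{k+1,i}` comes from
the diagonal term `b_{k,i} Θ_{ii}`; the rest is a fraction at most `C q^k` with `q < 1`
(`IsIndex.exists_excess`). Multiplying these estimates and passing to the limit that defines `λ_i`
gives `b_{k,i} λ_i(I_i^{(k)}) ≥ 1 - C q^k / (1 - q)` (`CompatibleVectors.le_returnTime_mul`).
Comparable scales: the return times grow at least like `p^{k(k-1)}`, so `-log λ_j(I_i^{(k)})` is at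
least quadratic in `k`. One stage adds only `O(k)` to it, because column sums of `Θ_k` are `O(a_k)`
and three consecutive matrices have a positive product (`CompatibleVectors.eventually_rpow_le`). -/

theorem insertAfter_of_not_mem {n : ℕ} {w l : Fin n} {L : List (Fin n)} (h : w ∉ L) :
    insertAfter w l L = L := by
  induction L with
  | nil => rfl
  | cons b L ih =>
    simp only [List.mem_cons, not_or] at h
    have : insertAfter w l (b :: L) = (if b = w then [w, l] else [b]) ++ insertAfter w l L := rfl
    rw [this, ih h.2, if_neg (Ne.symm h.1)]
    rfl

theorem insertAfter_middle {n : ℕ} {w l : Fin n} {A B : List (Fin n)} (hA : w ∉ A) (hB : w ∉ B) :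
    insertAfter w l (A ++ w :: B) = A ++ w :: l :: B := by
  have h1 : insertAfter w l (A ++ w :: B) = insertAfter w l A ++ insertAfter w l (w :: B) :=
    List.flatMap_append
  have h2 : insertAfter w l (w :: B) = (if w = w then [w, l] else [w]) ++ insertAfter w l B := rfl
  rw [h1, h2, insertAfter_of_not_mem hA, insertAfter_of_not_mem hB, if_pos rfl]
  rfl

section Track

variable {n : ℕ} [NeZero n]

/-- The effect of a Rauzy step on the combinatorial data and on the tower heights. -/
def advance (s : RauzyPair n × (Fin n → ℕ)) (e : RauzyType) : RauzyPair n × (Fin n → ℕ) :=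
  (s.1.move e, Function.update s.2 (s.1.loser e) (s.2 (s.1.loser e) + s.2 (s.1.winner e)))

/-- The effect of a Rauzy path on the combinatorial data and on the tower heights. -/
def track (s : RauzyPair n × (Fin n → ℕ)) (w : List RauzyType) : RauzyPair n × (Fin n → ℕ) :=
  w.foldl advance s

theorem track_cons (s : RauzyPair n × (Fin n → ℕ)) (e : RauzyType) (w : List RauzyType) :
    track s (e :: w) = track (advance s e) w := rfl

theorem track_append (s : RauzyPair n × (Fin n → ℕ)) (u v : List RauzyType) :
    track s (u ++ v) = track (track s u) v := List.foldl_append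

/-- On row vectors, `1 + E_{w,l}` adds the winner's entry to the loser's, exactly as tower heights
change. So the path matrix need never be written out: following an arbitrary height vector
determines it. -/
theorem vecMul_pathMatrix (π : RauzyPair n) (h : Fin n → ℕ) (w : List RauzyType) :
    Matrix.vecMul h (π.pathMatrix w) = (track (π, h) w).2 := by
  induction w generalizing π h with
  | nil => simp [RauzyPair.pathMatrix, track]
  | cons e w ih =>
    rw [track_cons, RauzyPair.pathMatrix, ← Matrix.vecMul_vecMul]
    have : Matrix.vecMul h (1 + Matrix.single (π.winner e) (π.loser e) 1)
        = Function.update h (π.loser e) (h (π.loser e) + h (π.winner e)) := by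
      rw [Matrix.vecMul_add, Matrix.vecMul_one]
      ext t
      by_cases ht : t = π.loser e
      · subst ht; simp [Matrix.vecMul, dotProduct, Matrix.single_apply]
      · simp [Matrix.vecMul, dotProduct, ht, Ne.symm ht]
    rw [this, ih]
    rfl

theorem run_pair (S : IETData n) (h : Fin n → ℕ) (w : List RauzyType) :
    (S.run w).pair = (track (S.pair, h) w).1 := by
  induction w generalizing S h with
  | nil => rfl
  | cons e w ih => exact ih (S.step e) _

theorem advance_one {A B D : List (Fin n)} {x l : Fin n} (h : Fin n → ℕ)
    (hA : x ∉ A) (hB : x ∉ B) :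
    advance (⟨A ++ x :: (B ++ [l]), D ++ [x]⟩, h) .one
      = (⟨A ++ x :: l :: B, D ++ [x]⟩, Function.update h l (h l + h x)) := by
  have e : A ++ x :: (B ++ [l]) = (A ++ x :: B) ++ [l] := by simp
  rw [e]
  simp only [advance, RauzyPair.move, RauzyPair.loser, RauzyPair.winner, List.getLastD_concat,
    List.dropLast_concat, insertAfter_middle hA hB]

theorem advance_zero {A B D : List (Fin n)} {x l : Fin n} (h : Fin n → ℕ)
    (hA : x ∉ A) (hB : x ∉ B) :
    advance (⟨D ++ [x], A ++ x :: (B ++ [l])⟩, h) .zero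
      = (⟨D ++ [x], A ++ x :: l :: B⟩, Function.update h l (h l + h x)) := by
  have e : A ++ x :: (B ++ [l]) = (A ++ x :: B) ++ [l] := by simp
  rw [e]
  simp only [advance, RauzyPair.move, RauzyPair.loser, RauzyPair.winner, List.getLastD_concat,
    List.dropLast_concat, insertAfter_middle hA hB]

/-- The winner is `x` throughout. Each step takes the last letter of the top row to the place behind
`x` and adds the height of `x` to it; in the induction this letter passes from `C` to the front of
`B`. -/
theorem track_rotate {A B C D : List (Fin n)} {x : Fin n} (h : Fin n → ℕ)
    (hn : (A ++ x :: (B ++ C)).Nodup) :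
    track (⟨A ++ x :: (B ++ C), D ++ [x]⟩, h) (List.replicate C.length .one)
      = (⟨A ++ x :: (C ++ B), D ++ [x]⟩, fun t => if t ∈ C then h t + h x else h t) := by
  induction C using List.reverseRecOn generalizing B h with
  | nil => simp [track]
  | append_singleton C l ih =>
    have hx : x ∉ A ∧ x ∉ B ++ C ∧ x ≠ l ∧ l ∉ C := by
      simp only [List.nodup_append, List.nodup_cons, List.mem_append, List.mem_cons] at hn
      simp only [List.mem_append]
      grind
    have hp : (A ++ x :: (B ++ (C ++ [l]))).Perm (A ++ x :: ((l :: B) ++ C)) := by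
      refine List.Perm.append_left _ (List.Perm.cons _ ?_)
      rw [← List.append_assoc]
      exact List.perm_append_singleton l (B ++ C)
    have hn' := hp.nodup_iff.1 hn
    rw [List.length_append, List.length_singleton, List.replicate_succ, track_cons,
      ← List.append_assoc B, advance_one h hx.1 hx.2.1]
    have := ih (B := l :: B) (Function.update h l (h l + h x)) hn'
    rw [List.cons_append] at this
    rw [this]
    refine Prod.ext (by simp) ?_
    funext t
    by_cases ht : t = l
    · subst ht; simp [hx.2.2.2]
    · simp [ht, Function.update_of_ne hx.2.2.1]

/-- The loser `x` already stands directly behind the winner `y`, so reinserting it changes nothing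
but its height. -/
theorem track_replicate_zero {Y D : List (Fin n)} {x y : Fin n} (h : Fin n → ℕ) (a : ℕ)
    (hY : y ∉ Y) (hxy : x ≠ y) :
    track (⟨D ++ [y], Y ++ [y, x]⟩, h) (List.replicate a .zero)
      = (⟨D ++ [y], Y ++ [y, x]⟩, Function.update h x (h x + a * h y)) := by
  induction a generalizing h with
  | zero => simp [track]
  | succ a ih =>
    rw [List.replicate_succ, track_cons]
    have := advance_zero (A := Y) (B := []) (D := D) (x := y) (l := x) h hY (by simp)
    simp only [List.nil_append] at this
    rw [this, ih]
    simp only [Function.update_self, Function.update_idem, Function.update_of_ne hxy.symm]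
    congr 2
    ring

/-- One block `γ̇` acts on one exchanged pair. The top row is restored, the pair `y, x` travels from
the end of the bottom row to the place behind `z`, and the parameter `a` multiplies the height of
`y` in both new heights of the pair. -/
theorem track_dot {A B Y : List (Fin n)} {x y z : Fin n} (h : Fin n → ℕ) (a : ℕ)
    (ht : (A ++ x :: y :: (B ++ [z])).Nodup) (hb : (z :: (Y ++ [y, x])).Nodup) :
    track (⟨A ++ x :: y :: (B ++ [z]), z :: (Y ++ [y, x])⟩, h)
      (List.replicate (B.length + 1) .one ++ List.replicate a .zero ++ [.one, .zero, .zero])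
      = (⟨A ++ x :: y :: (B ++ [z]), z :: y :: x :: Y⟩,
        fun t => if t = x then 2 * h x + a * h y + h z
          else if t = y then 2 * h x + (a + 1) * h y + h z
          else if t ∈ B ++ [z] then h t + h x else h t) := by
  have hx : x ∉ A ∧ x ≠ y ∧ x ∉ B ∧ x ≠ z ∧ y ∉ B ∧ y ≠ z ∧ z ∉ B := by
    simp only [List.nodup_append, List.nodup_cons, List.mem_append, List.mem_cons] at ht
    grind
  obtain ⟨hxA, hxy, hxB, hxz, hyB, hyz, hzB⟩ := hx
  have hY : z ∉ Y ∧ y ∉ Y ∧ x ∉ Y := by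
    simp only [List.nodup_append, List.nodup_cons, List.mem_append, List.mem_cons] at hb
    grind
  obtain ⟨hzY, hyY, hxY⟩ := hY
  rw [track_append, track_append]
  -- The initial steps of type 1 carry `B` and `z` behind `x`; this leaves `y` at the end of the top
  -- row, as winner of the `a` steps of type 0.
  have h1 := track_rotate (A := A) (B := [y]) (C := B ++ [z]) (D := z :: (Y ++ [y])) (x := x) h
    (by simpa using ht)
  simp only [List.length_append, List.length_singleton, List.cons_append, List.append_assoc,
    List.nil_append] at h1
  rw [h1]
  set h' : Fin n → ℕ := fun t => if t ∈ B ++ [z] then h t + h x else h t with hh'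
  have h2 := track_replicate_zero (Y := z :: Y) (D := A ++ x :: (B ++ [z])) (x := x) (y := y) h' a
    (by simp [hyz, hyY]) hxy
  simp only [List.cons_append, List.append_assoc, List.nil_append] at h2
  rw [h2, track_cons, track_cons, track_cons]
  -- The single step of type 1 puts `y` back behind `x`. Then `z` is last in the top row and wins
  -- the two steps of type 0, against `x` and then against `y`.
  have h3 := advance_one (A := A) (B := B ++ [z]) (D := z :: (Y ++ [y])) (x := x) (l := y)
    (Function.update h' x (h' x + a * h' y)) hxA (by simp [hxB, hxz])
  simp only [List.cons_append, List.append_assoc, List.nil_append] at h3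
  rw [h3]
  have h4 := fun g => advance_zero (A := []) (B := Y ++ [y]) (D := A ++ x :: y :: B) (x := z)
    (l := x) g (by simp) (by simp [hzY, hyz.symm])
  simp only [List.cons_append, List.append_assoc, List.nil_append] at h4
  rw [h4]
  have h5 := fun g => advance_zero (A := []) (B := x :: Y) (D := A ++ x :: y :: B) (x := z)
    (l := y) g (by simp) (by simp [hzY, hxz.symm])
  simp only [List.cons_append, List.append_assoc, List.nil_append] at h5
  rw [h5]
  simp only [track, List.foldl_nil]
  refine Prod.ext rfl ?_
  have e1 : h' x = h x := by simp [hh', hxB, hxz]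
  have e2 : h' y = h y := by simp [hh', hyB, hyz]
  have e3 : h' z = h z + h x := by simp [hh']
  funext t
  by_cases htx : t = x
  · subst htx
    simp [hxy, hxy.symm, hxz.symm, hyz.symm, e1, e2, e3]
    ring
  · by_cases hty : t = y
    · subst hty
      simp [hxy, hxy.symm, hxz.symm, hyz.symm, e1, e2, e3]
      ring
    · simp [htx, hty, hh']

end Track

/-! ### The closed path as a map of height vectors. -/

section Cycle

variable {n : ℕ} [NeZero n]

/-- The label at an odd position; it is the first of a pair of neighbours that `basePair`
exchanges. -/
def pairFst (n : ℕ) [NeZero n] (r : ℕ) : Fin n := Fin.ofNat n (2 * r + 1)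

/-- The second label of a pair of neighbours that `basePair` exchanges. -/
def pairSnd (n : ℕ) [NeZero n] (r : ℕ) : Fin n := Fin.ofNat n (2 * r + 2)

/-- The last label. -/
def lastLabel (n : ℕ) [NeZero n] : Fin n := Fin.ofNat n (n - 1)

/-- The last label but one. -/
def penLabel (n : ℕ) [NeZero n] : Fin n := Fin.ofNat n (n - 2)

/-- The first `m` exchanged pairs in the bottom row of `basePair`. -/
def swappedPairs (n : ℕ) [NeZero n] (m : ℕ) : List (Fin n) :=
  (List.range m).flatMap fun r => [pairSnd n r, pairFst n r]

theorem swappedPairs_succ (m : ℕ) :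
    swappedPairs n (m + 1) = swappedPairs n m ++ [pairSnd n m, pairFst n m] := by
  simp [swappedPairs, List.range_succ, List.flatMap_append]

theorem val_pairFst {r : ℕ} (h : 2 * r + 1 < n) : (pairFst n r).val = 2 * r + 1 := by
  simp [pairFst, Fin.ofNat, Nat.mod_eq_of_lt h]

theorem val_pairSnd {r : ℕ} (h : 2 * r + 2 < n) : (pairSnd n r).val = 2 * r + 2 := by
  simp [pairSnd, Fin.ofNat, Nat.mod_eq_of_lt h]

theorem val_lastLabel : (lastLabel n).val = n - 1 := by
  have := NeZero.pos n
  simp [lastLabel, Fin.ofNat, Nat.mod_eq_of_lt (show n - 1 < n by omega)]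

theorem val_penLabel : (penLabel n).val = n - 2 := by
  have := NeZero.pos n
  simp [penLabel, Fin.ofNat, Nat.mod_eq_of_lt (show n - 2 < n by omega)]

theorem finRange_decomp {m : ℕ} (hm : 2 * m + 4 ≤ n) :
    ∃ A B : List (Fin n), List.finRange n
        = A ++ pairFst n m :: pairSnd n m :: (B ++ [lastLabel n])
      ∧ B.length + 1 = n - 1 - 2 * (m + 1)
      ∧ ∀ t, t ∈ B ++ [lastLabel n] ↔ 2 * m + 3 ≤ t.val := by
  have hl : (List.finRange n).length = n := List.length_finRange
  set L := List.finRange n with hL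
  have hne : L.drop (2 * m + 3) ≠ [] := by
    intro h
    have := congrArg List.length h
    rw [List.length_drop, hl] at this
    simp only [List.length_nil] at this
    omega
  have hlast : (L.drop (2 * m + 3)).getLast hne = lastLabel n := by
    apply Fin.ext
    rw [List.getLast_eq_getElem, List.getElem_drop, val_lastLabel]
    simp only [hL, List.getElem_finRange, List.length_drop, List.length_finRange, Fin.cast_mk]
    omega
  have hd : (L.drop (2 * m + 3)).dropLast ++ [lastLabel n] = L.drop (2 * m + 3) := by
    rw [← hlast]; exact List.dropLast_append_getLast hne
  refine ⟨L.take (2 * m + 1), (L.drop (2 * m + 3)).dropLast, ?_, ?_, ?_⟩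
  · rw [hd]
    conv_lhs => rw [← List.take_append_drop (2 * m + 1) L]
    rw [List.drop_eq_getElem_cons (by omega), List.drop_eq_getElem_cons (by omega)]
    congr 2
    · apply Fin.ext
      rw [val_pairFst (by omega)]
      simp [hL]
    · congr 1
      apply Fin.ext
      rw [val_pairSnd (by omega)]
      simp [hL]
  · rw [List.length_dropLast, List.length_drop, hl]; omega
  · intro t
    rw [hd, List.mem_drop_iff_getElem]
    constructor
    · rintro ⟨i, hi, rfl⟩
      simp [hL]
    · intro ht
      exact ⟨t.val - (2 * m + 3), by have := t.2; omega, by apply Fin.ext; simp [hL]; omega⟩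

/-- The pairs are treated from the last to the first, each being moved to the front, so their order
is restored in the end; `X` holds what has been moved already. Treating the pair `r` adds the height
of `pairFst n r` to every label further right. A pair thus meets a last label that has absorbed the
later pairs, and afterwards receives the earlier ones itself; hence the full sum in each formula. -/
theorem track_dots (m : ℕ) (hm : 2 * m + 2 ≤ n) (a : ℕ) (X : List (Fin n)) (h : Fin n → ℕ)
    (hb : (lastLabel n :: (X ++ 0 :: swappedPairs n m)).Nodup) :
    ∃ h' : Fin n → ℕ,
      track (⟨List.finRange n, lastLabel n :: (X ++ 0 :: swappedPairs n m)⟩, h)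
        ((List.range m).reverse.flatMap fun r => dotPath n (2 * (r + 1)) a)
        = (⟨List.finRange n, lastLabel n :: (swappedPairs n m ++ X ++ [0])⟩, h')
      ∧ h' 0 = h 0
      ∧ h' (lastLabel n) = h (lastLabel n) + ∑ r ∈ Finset.range m, h (pairFst n r)
      ∧ (∀ r < m, h' (pairFst n r) = h (lastLabel n) + ∑ r ∈ Finset.range m, h (pairFst n r)
          + h (pairFst n r) + a * h (pairSnd n r))
      ∧ (∀ r < m, h' (pairSnd n r) = h (lastLabel n) + ∑ r ∈ Finset.range m, h (pairFst n r)
          + h (pairFst n r) + (a + 1) * h (pairSnd n r))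
      ∧ ∀ t, 2 * m + 1 ≤ t.val → t ≠ lastLabel n →
          h' t = h t + ∑ r ∈ Finset.range m, h (pairFst n r) := by
  induction m generalizing X h with
  | zero => exact ⟨h, by simp [swappedPairs, track], by simp, by simp, by simp, by simp, by simp⟩
  | succ m ih =>
    obtain ⟨A, B, hL, hB, hmem⟩ := finRange_decomp (n := n) (m := m) (by omega)
    have hnd : (A ++ pairFst n m :: pairSnd n m :: (B ++ [lastLabel n])).Nodup := by
      rw [← hL]; exact List.nodup_finRange n
    have key := track_dot h a hnd (Y := X ++ 0 :: swappedPairs n m)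
      (by simpa [swappedPairs_succ] using hb)
    rw [← hL, hB] at key
    set h1 : Fin n → ℕ := _ with hh1
    change _ = (_, h1) at key
    have hb' : (lastLabel n ::
        ((pairSnd n m :: pairFst n m :: X) ++ 0 :: swappedPairs n m)).Nodup := by
      refine (List.Perm.nodup_iff ?_).1 hb
      refine List.Perm.cons _ ?_
      rw [swappedPairs_succ]
      have : X ++ 0 :: (swappedPairs n m ++ [pairSnd n m, pairFst n m])
          = (X ++ 0 :: swappedPairs n m) ++ [pairSnd n m, pairFst n m] := by simp
      rw [this]
      exact List.perm_append_comm
    obtain ⟨h', h2, h0, hz, hx, hy, ho⟩ := ih (by omega) _ h1 hb'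
    have vx := fun r (hr : r < m + 1) => val_pairFst (n := n) (r := r) (by omega)
    have vy := fun r (hr : r < m + 1) => val_pairSnd (n := n) (r := r) (by omega)
    have vz := val_lastLabel (n := n)
    have e (t s : Fin n) (hts : t.val ≠ s.val) : t ≠ s := fun h => hts (congrArg _ h)
    have hlow : ∀ t : Fin n, t.val < 2 * m + 1 → h1 t = h t := by
      intro t ht
      have h3 := vx m (by omega)
      have h4 := vy m (by omega)
      simp only [hh1, hmem]
      rw [if_neg (e _ _ (by omega)), if_neg (e _ _ (by omega)), if_neg (by omega)]
    have hhigh : ∀ t : Fin n, 2 * m + 3 ≤ t.val → h1 t = h t + h (pairFst n m) := by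
      intro t ht
      have h3 := vx m (by omega)
      have h4 := vy m (by omega)
      simp only [hh1, hmem]
      rw [if_neg (e _ _ (by omega)), if_neg (e _ _ (by omega)), if_pos (by omega)]
    have h1x : h1 (pairFst n m) = 2 * h (pairFst n m) + a * h (pairSnd n m) + h (lastLabel n) := by
      simp only [hh1, if_true]
    have h1y : h1 (pairSnd n m)
        = 2 * h (pairFst n m) + (a + 1) * h (pairSnd n m) + h (lastLabel n) := by
      have h3 := vx m (by omega)
      have h4 := vy m (by omega)
      simp only [hh1]; rw [if_neg (e _ _ (by omega)), if_pos trivial]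
    have h1z : h1 (lastLabel n) = h (lastLabel n) + h (pairFst n m) := hhigh _ (by omega)
    have hS : ∑ r ∈ Finset.range m, h1 (pairFst n r) = ∑ r ∈ Finset.range m, h (pairFst n r) := by
      refine Finset.sum_congr rfl fun r hr => hlow _ ?_
      have := Finset.mem_range.1 hr
      rw [vx r (by omega)]; omega
    rw [hS] at hz hx hy ho
    refine ⟨h', ?_, ?_, ?_, ?_, ?_, ?_⟩
    · rw [List.range_succ, List.reverse_append, List.reverse_singleton, List.singleton_append,
        List.flatMap_cons, track_append, dotPath]
      have : lastLabel n :: (X ++ 0 :: swappedPairs n (m + 1)) = lastLabel n ::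
          ((X ++ 0 :: swappedPairs n m) ++ [pairSnd n m, pairFst n m]) := by
        simp [swappedPairs_succ]
      rw [this, key]
      refine h2.trans ?_
      simp [swappedPairs_succ]
    · rw [h0]; exact hlow _ (by simp)
    · rw [hz, h1z, Finset.sum_range_succ]; ring
    · intro r hr
      rw [Finset.sum_range_succ]
      rcases Nat.lt_succ_iff_lt_or_eq.1 hr with hr | rfl
      · rw [hx r hr, h1z, hlow _ (by rw [vx r (by omega)]; omega),
          hlow _ (by rw [vy r (by omega)]; omega)]
        ring
      · rw [ho _ (by rw [vx r (by omega)]) (e _ _ (by rw [vx r (by omega)]; omega)), h1x]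
        ring
    · intro r hr
      rw [Finset.sum_range_succ]
      rcases Nat.lt_succ_iff_lt_or_eq.1 hr with hr | rfl
      · rw [hy r hr, h1z, hlow _ (by rw [vx r (by omega)]; omega),
          hlow _ (by rw [vy r (by omega)]; omega)]
        ring
      · rw [ho _ (by rw [vy r (by omega)]; omega) (e _ _ (by rw [vy r (by omega)]; omega)), h1y]
        ring
    · intro t ht htz
      rw [ho t (by omega) htz, hhigh t (by omega), Finset.sum_range_succ]
      ring

theorem range'_pairs (m : ℕ) :
    List.range' 1 (2 * m) = (List.range m).flatMap fun r => [2 * r + 1, 2 * r + 2] := by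
  induction m with
  | zero => rfl
  | succ m ih =>
    rw [List.range_succ, List.flatMap_append, ← ih, mul_add,
      show 2 * m + 2 * 1 = 2 * m + 2 from rfl, ← List.range'_append_1]
    simp [List.range']
    omega

theorem basePair_bot (m : ℕ) (hm : 1 ≤ m) (hn : n = 2 * m + 2 ∨ n = 2 * m + 3) :
    (basePair n).bot = lastLabel n :: (swappedPairs n m ++
      ((if n % 2 = 1 then [penLabel n] else []) ++ [0])) := by
  set g : ℕ → Fin n := fun q => if q = 0 then Fin.ofNat n (n - 1)
    else if q = n - 1 then 0
    else if q % 2 = 1 then (if q + 1 ≤ n - 2 then Fin.ofNat n (q + 1) else Fin.ofNat n q)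
    else Fin.ofNat n (q - 1) with hg
  have h1 : (basePair n).bot = (List.range n).map g := by
    rw [← List.map_coe_finRange_eq_range, List.map_map]
    refine List.map_congr_left fun q _ => ?_
    have hq : Fin.ofNat n q.val = q := by
      apply Fin.ext; simp [Fin.ofNat, Nat.mod_eq_of_lt q.2]
    simp only [hg, Function.comp, hq]
  have h2 : (List.range' 1 (2 * m)).map g = swappedPairs n m := by
    rw [range'_pairs, List.map_flatMap, swappedPairs]
    refine List.flatMap_congr fun r hr => ?_
    have hr := List.mem_range.1 hr
    have e1 : g (2 * r + 1) = pairSnd n r := by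
      simp only [hg]
      rw [if_neg (by omega), if_neg (by omega), if_pos (by omega), if_pos (by omega)]; rfl
    have e2 : g (2 * r + 2) = pairFst n r := by
      simp only [hg]
      rw [if_neg (by omega), if_neg (by omega), if_neg (by omega)]; rfl
    simp [e1, e2]
  have g0 : g 0 = lastLabel n := by simp [hg, lastLabel]
  have gl : g (n - 1) = 0 := by
    simp only [hg]; rw [if_neg (by omega), if_pos trivial]
  rw [h1, List.range_eq_range']
  rcases hn with hn | hn
  · have : List.range' 0 n = 0 :: (List.range' 1 (2 * m) ++ [n - 1]) := by
      conv_lhs => rw [hn]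
      rw [List.range'_succ, ← List.range'_append_1]
      simp; omega
    rw [this, if_neg (by omega)]
    simp [h2, g0, gl]
  · have : List.range' 0 n = 0 :: (List.range' 1 (2 * m) ++ [n - 2, n - 1]) := by
      conv_lhs => rw [hn]
      rw [List.range'_succ, ← List.range'_append_1]
      simp [List.range']; omega
    have gl2 : g (n - 2) = penLabel n := by
      simp only [hg]
      rw [if_neg (by omega), if_neg (by omega), if_pos (by omega), if_neg (by omega)]
      rfl
    rw [this, if_pos (by omega)]
    simp [h2, g0, gl, gl2]

theorem basePair_bot_nodup (hn : 2 < n) : (basePair n).bot.Nodup := by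
  refine List.Nodup.map ?_ (List.nodup_finRange n)
  refine Function.Involutive.injective fun q => ?_
  have hq := q.2
  have ho : ∀ k < n, (Fin.ofNat n k).val = k := fun k hk => by
    simp [Fin.ofNat, Nat.mod_eq_of_lt hk]
  apply Fin.ext
  have h1 := ho (n - 1) (by omega)
  have h0 : (0 : Fin n).val = 0 := rfl
  by_cases a1 : q.val = 0
  · simp only [a1, if_true]
    rw [if_neg (by omega), if_pos (by omega), h0]
  by_cases a2 : q.val = n - 1
  · simp only [a1, if_false, if_pos a2, h0, if_true]
    rw [h1]; omega
  by_cases a3 : q.val % 2 = 1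
  · by_cases a4 : q.val + 1 ≤ n - 2
    · have h2 := ho (q.val + 1) (by omega)
      simp only [if_neg a1, if_neg a2, if_pos a3, if_pos a4]
      rw [if_neg (by omega), if_neg (by omega), if_neg (by omega), ho _ (by omega)]; omega
    · simp only [if_neg a1, if_neg a2, if_pos a3, if_neg a4]
  · have h2 := ho (q.val - 1) (by omega)
    simp only [if_neg a1, if_neg a2, if_neg a3]
    rw [if_neg (by omega), if_neg (by omega), if_pos (by omega), if_pos (by omega), ho _ (by omega)]
    omega

theorem finRange_eq_cons : ∃ C : List (Fin n), List.finRange n = 0 :: C ∧ C.length = n - 1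
    ∧ ∀ t, t ∈ C ↔ t ≠ 0 := by
  have hl : (List.finRange n).length = n := List.length_finRange
  have hpos := NeZero.pos n
  have h1 : List.finRange n = 0 :: (List.finRange n).drop 1 := by
    conv_lhs => rw [← List.drop_zero (l := List.finRange n)]
    rw [List.drop_eq_getElem_cons (by omega)]
    congr 1
    simp
  refine ⟨_, h1, by rw [List.length_drop, hl], fun t => ?_⟩
  have hnd := List.nodup_finRange n
  have hm := List.mem_finRange t
  rw [h1] at hnd hm
  rw [List.nodup_cons] at hnd
  rw [List.mem_cons] at hm
  constructor
  · rintro h rfl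
    exact hnd.1 h
  · intro h
    exact hm.resolve_left h

/-- With winner `0` at the head of the top row, `n - 1` steps of type 1 rotate all other labels once
around and give each of them the height of `0`. -/
theorem track_full_rotations (D : List (Fin n)) (h : Fin n → ℕ) (c : ℕ) :
    track (⟨List.finRange n, D ++ [0]⟩, h) (List.replicate (c * (n - 1)) .one)
      = (⟨List.finRange n, D ++ [0]⟩, fun t => if t = 0 then h 0 else h t + c * h 0) := by
  obtain ⟨C, hC, hlen, hmem⟩ := finRange_eq_cons (n := n)
  induction c generalizing h with
  | zero =>
    simp only [zero_mul, List.replicate_zero, track, List.foldl_nil, add_zero]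
    refine Prod.ext rfl ?_
    funext t
    by_cases ht : t = 0 <;> simp [ht]
  | succ c ih =>
    have h1 := track_rotate (A := []) (B := []) (C := C) (D := D) (x := 0) h
      (by simpa [← hC] using List.nodup_finRange n)
    simp only [List.nil_append, List.append_nil, ← hC, hlen] at h1
    rw [add_mul, one_mul, add_comm, List.replicate_add, track_append, h1, ih]
    refine Prod.ext rfl ?_
    funext t
    by_cases ht : t = 0
    · simp [ht, hmem]
    · simp only [ht, hmem, if_false, ne_eq, not_true, not_false_iff, if_true]
      ring

theorem finRange_eq_append_pair (hn : 2 ≤ n) :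
    ∃ D : List (Fin n), List.finRange n = D ++ [penLabel n, lastLabel n] := by
  have hl : (List.finRange n).length = n := List.length_finRange
  refine ⟨(List.finRange n).take (n - 2), ?_⟩
  conv_lhs => rw [← List.take_append_drop (n - 2) (List.finRange n)]
  rw [List.drop_eq_getElem_cons (by omega), List.drop_eq_getElem_cons (by omega),
    List.drop_of_length_le (by omega)]
  congr 2
  · apply Fin.ext
    rw [val_penLabel]
    simp
  · congr 1
    apply Fin.ext
    rw [val_lastLabel]
    simp; omega

/-- The sum of the entries at odd labels other than the last one. -/
def oddSum (h : Fin n → ℕ) : ℕ :=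
  ∑ r ∈ Finset.range (n / 2 - 1), h (pairFst n r)
    + if n % 2 = 1 then h (penLabel n) else 0

/-- The path is closed, and these recursions hold all the information on `Theta` that is used later.
The last label reproduces itself with factor about `c`, and each `pairSnd` with factor about `a`;
the first label gets no large factor. -/
theorem track_cycle (hn : 4 ≤ n) (a c : ℕ) (h : Fin n → ℕ) :
    ∃ h' : Fin n → ℕ, track (basePair n, h) (cycle n a c) = (basePair n, h')
      ∧ h' 0 = h 0 + h (lastLabel n)
      ∧ h' (lastLabel n) = c * (h 0 + h (lastLabel n)) + h (lastLabel n) + oddSum h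
      ∧ (∀ r < n / 2 - 1, h' (pairFst n r)
          = h' (lastLabel n) + h (pairFst n r) + a * h (pairSnd n r))
      ∧ (∀ r < n / 2 - 1, h' (pairSnd n r)
          = h' (lastLabel n) + h (pairFst n r) + (a + 1) * h (pairSnd n r))
      ∧ (n % 2 = 1 → h' (penLabel n)
          = h' (lastLabel n) + h (penLabel n)) := by
  set m := n / 2 - 1 with hm
  have hnm : n = 2 * m + 2 ∨ n = 2 * m + 3 := by omega
  set X : List (Fin n) := if n % 2 = 1 then [penLabel n] else [] with hX
  have hbot := basePair_bot (n := n) m (by omega) hnm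
  rw [← hX] at hbot
  have hnd := basePair_bot_nodup (n := n) (by omega)
  rw [hbot] at hnd
  have hnd2 : (lastLabel n :: (X ++ 0 :: swappedPairs n m)).Nodup := by
    refine (List.Perm.nodup_iff (List.Perm.cons _ ?_)).1 hnd
    exact (List.perm_append_comm).trans (by simp)
  have hbase : basePair n = ⟨List.finRange n, lastLabel n :: (swappedPairs n m ++ (X ++ [0]))⟩ := by
    rw [← hbot]; rfl
  obtain ⟨D, hD⟩ := finRange_eq_append_pair (n := n) (by omega)
  have vz := val_lastLabel (n := n)
  have v0 : (0 : Fin n).val = 0 := rfl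
  have vq := val_penLabel (n := n)
  have vx := fun r (hr : r < m) => val_pairFst (n := n) (r := r) (by omega)
  have vy := fun r (hr : r < m) => val_pairSnd (n := n) (r := r) (by omega)
  have e (t s : Fin n) (hts : t.val ≠ s.val) : t ≠ s := fun h => hts (congrArg _ h)
  have hz0 : lastLabel n ≠ 0 := e _ _ (by omega)
  have hzX : lastLabel n ∉ swappedPairs n m ∧ lastLabel n ∉ X := by
    simp only [List.nodup_cons, List.mem_append, not_or] at hnd
    exact ⟨hnd.1.1, hnd.1.2.1⟩
  -- the steps before the first `dotPath`
  obtain ⟨g, hg, hg0, hgz, hgq, hgo⟩ : ∃ g : Fin n → ℕ,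
      track (basePair n, h) ([.zero] ++ (if n % 2 = 1 then [.one, .zero] else []))
        = (⟨List.finRange n, lastLabel n :: (X ++ 0 :: swappedPairs n m)⟩, g)
      ∧ g 0 = h 0 + h (lastLabel n)
      ∧ g (lastLabel n) = h (lastLabel n) + (if n % 2 = 1 then h (penLabel n) else 0)
      ∧ (n % 2 = 1 → g (penLabel n) = g (lastLabel n) + h (penLabel n))
      ∧ ∀ t : Fin n, 0 < t.val → t.val ≤ 2 * m → g t = h t := by
    have s1 := advance_zero (A := []) (B := swappedPairs n m ++ X)
      (D := D ++ [penLabel n]) (x := lastLabel n) (l := 0) h (by simp)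
      (by simp [hzX.1, hzX.2])
    simp only [List.nil_append, List.append_assoc, List.cons_append, ← hD, ← hbase] at s1
    rw [track_append, track_cons, s1]
    by_cases ho : n % 2 = 1
    · simp only [if_pos ho] at hX ⊢
      rw [hX] at hnd ⊢
      have hDn := List.nodup_finRange n
      rw [hD] at hDn
      have hqs : penLabel n ∉ D ∧ penLabel n ∉ swappedPairs n m := by
        simp only [List.nodup_append, List.nodup_cons, List.mem_cons, List.mem_append] at hDn hnd
        grind
      have hqz : penLabel n ≠ lastLabel n := e _ _ (by omega)
      have hq0 : penLabel n ≠ 0 := e _ _ (by omega)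
      -- For odd `n` the extra steps `10` take the unpaired label `penLabel n` to the front of the
      -- bottom row. The step of type 1 changes only a height, since its loser already stands behind
      -- its winner.
      have s2 := fun g => advance_one (A := D) (B := []) (D := lastLabel n :: 0 :: swappedPairs n m)
        (x := penLabel n) (l := lastLabel n) g hqs.1 (by simp)
      simp only [List.nil_append, List.cons_append, ← hD] at s2
      have s3 := fun g => advance_zero (A := []) (B := 0 :: swappedPairs n m)
        (D := D ++ [penLabel n]) (x := lastLabel n) (l := penLabel n) g
        (by simp) (by simp [hz0, hzX.1])
      simp only [List.nil_append, List.append_assoc, List.cons_append, ← hD] at s3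
      simp only [track, List.foldl_nil, List.foldl_cons]
      rw [s2, s3]
      refine ⟨_, rfl, ?_, ?_, ?_, ?_⟩
      · simp [hz0.symm, hq0.symm]
      · simp [hz0, hqz, hqz.symm, hq0]
      · intro _
        simp [hz0, hqz, hqz.symm, hq0]
        ring
      · intro t h0 h1
        rw [Function.update_of_ne (e _ _ (by omega)), Function.update_of_ne (e _ _ (by omega)),
          Function.update_of_ne (e _ _ (by omega))]
    · simp only [if_neg ho] at hX ⊢
      rw [hX]
      simp only [track, List.foldl_nil]
      refine ⟨_, by rw [List.append_nil]; rfl, ?_, ?_, ?_, ?_⟩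
      · simp
      · simp [hz0]
      · intro h; exact absurd h ho
      · intro t h0 h1
        rw [Function.update_of_ne (e _ _ (by omega))]
  obtain ⟨f, hf, hf0, hfz, hfx, hfy, hfo⟩ := track_dots m (by omega) a X g hnd2
  have hS : ∑ r ∈ Finset.range m, g (pairFst n r) = ∑ r ∈ Finset.range m, h (pairFst n r) := by
    refine Finset.sum_congr rfl fun r hr => ?_
    have := Finset.mem_range.1 hr
    exact hgo _ (by rw [vx r this]; omega) (by rw [vx r this]; omega)
  rw [hS] at hfz hfx hfy hfo
  have hfin := track_full_rotations (lastLabel n :: (swappedPairs n m ++ X)) f c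
  simp only [List.cons_append, List.append_assoc, ← hbase] at hfin
  simp only [List.append_assoc, ← hbase] at hf
  have hfz' : f (lastLabel n) = h (lastLabel n) + oddSum h := by
    rw [hfz, hgz, oddSum]; ring
  refine ⟨fun t => if t = 0 then f 0 else f t + c * f 0, ?_, ?_, ?_, ?_, ?_, ?_⟩
  · rw [cycle, track_append, track_append, hg, ← hm, hf, hfin]
  · simp only [if_true, hf0, hg0]
  · simp only [hz0, if_false, hfz', hf0, hg0]
    ring
  · intro r hr
    simp only [hz0, e (pairFst n r) 0 (by rw [vx r hr]; omega), if_false, hfz', hfx r hr, hgz]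
    rw [hgo _ (by rw [vx r hr]; omega) (by rw [vx r hr]; omega),
      hgo _ (by rw [vy r hr]; omega) (by rw [vy r hr]; omega), oddSum, ← hm]
    ring
  · intro r hr
    simp only [hz0, e (pairSnd n r) 0 (by rw [vy r hr]; omega), if_false, hfz', hfy r hr, hgz]
    rw [hgo _ (by rw [vx r hr]; omega) (by rw [vx r hr]; omega),
      hgo _ (by rw [vy r hr]; omega) (by rw [vy r hr]; omega), oddSum, ← hm]
    ring
  · intro ho
    have h1 := hfo (penLabel n) (by omega) (e _ _ (by omega))
    simp only [hz0, e (penLabel n) 0 (by omega), if_false]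
    rw [h1, hgq ho, hfz]
    ring

end Cycle

/-! ### The geometry of a Rauzy step -/

section Offset

variable {n : ℕ}

theorem offset_nil (len : Fin n → ℝ) (t : Fin n) : offset [] len t = 0 := by simp [offset]

theorem offset_cons (b : Fin n) (L : List (Fin n)) (len : Fin n → ℝ) (t : Fin n) :
    offset (b :: L) len t = if b = t then 0 else len b + offset L len t := by
  by_cases h : b = t <;> simp [offset, h]

theorem offset_append_of_mem {A : List (Fin n)} (B : List (Fin n)) (len : Fin n → ℝ) {t : Fin n}
    (h : t ∈ A) : offset (A ++ B) len t = offset A len t := by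
  induction A with
  | nil => simp at h
  | cons b A ih =>
    rw [List.cons_append, offset_cons, offset_cons]
    by_cases hb : b = t
    · simp [hb]
    · rw [if_neg hb, if_neg hb, ih ((List.mem_cons.1 h).resolve_left (Ne.symm hb))]

theorem offset_append_of_not_mem {A : List (Fin n)} (B : List (Fin n)) (len : Fin n → ℝ)
    {t : Fin n} (h : t ∉ A) : offset (A ++ B) len t = (A.map len).sum + offset B len t := by
  induction A with
  | nil => simp
  | cons b A ih =>
    rw [List.mem_cons, not_or] at h
    rw [List.cons_append, offset_cons, if_neg (Ne.symm h.1), ih h.2]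
    simp [add_assoc]

theorem offset_congr {L : List (Fin n)} {len len' : Fin n → ℝ} (t : Fin n)
    (h : ∀ s ∈ L, len s = len' s) : offset L len t = offset L len' t := by
  induction L with
  | nil => simp [offset_nil]
  | cons b L ih =>
    rw [offset_cons, offset_cons, ih fun s hs => h s (List.mem_cons_of_mem _ hs),
      h b List.mem_cons_self]

theorem sum_map_perm {L : List (Fin n)} (hL : L.Perm (List.finRange n)) (f : Fin n → ℝ) :
    (L.map f).sum = ∑ t, f t := by
  rw [(hL.map f).sum_eq, Fin.sum_univ_def]

theorem offset_last {D : List (Fin n)} {w : Fin n} (hQ : (D ++ [w]).Perm (List.finRange n))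
    (len : Fin n → ℝ) : offset (D ++ [w]) len w = ∑ t, len t - len w := by
  have hn := hQ.nodup_iff.2 (List.nodup_finRange n)
  have hw : w ∉ D := by
    rw [List.nodup_append] at hn
    grind
  rw [offset_append_of_not_mem _ _ hw, offset_cons, if_pos rfl, ← sum_map_perm hQ len]
  simp

theorem offset_shorten_last {D : List (Fin n)} {w : Fin n}
    (hQ : (D ++ [w]).Perm (List.finRange n)) (len : Fin n → ℝ) (v : ℝ) (t : Fin n) :
    offset (D ++ [w]) (Function.update len w v) t = offset (D ++ [w]) len t := by
  have hn := hQ.nodup_iff.2 (List.nodup_finRange n)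
  have hw : ∀ s ∈ D, s ≠ w := by
    rw [List.nodup_append] at hn
    grind
  have hc : ∀ s ∈ D, Function.update len w v s = len s := fun s hs =>
    Function.update_of_ne (hw s hs) _ _
  have ht : t ∈ D ++ [w] := hQ.mem_iff.2 (List.mem_finRange t)
  by_cases h : t ∈ D
  · rw [offset_append_of_mem _ _ h, offset_append_of_mem _ _ h, offset_congr t hc]
  · have : t = w := by simpa [h] using ht
    subst this
    rw [offset_append_of_not_mem _ _ h, offset_append_of_not_mem _ _ h, List.map_congr_left hc]
    simp [offset_cons]

/-- The winner loses exactly the length that the inserted loser takes up, so no other left endpoint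
moves. -/
theorem offset_insert {A B : List (Fin n)} {w l : Fin n}
    (hP : (A ++ w :: (B ++ [l])).Perm (List.finRange n)) (len : Fin n → ℝ) {t : Fin n}
    (ht : t ≠ l) :
    offset (A ++ w :: l :: B) (Function.update len w (len w - len l)) t
      = offset (A ++ w :: (B ++ [l])) len t := by
  have hn := hP.nodup_iff.2 (List.nodup_finRange n)
  have hm : t ∈ A ++ w :: (B ++ [l]) := hP.mem_iff.2 (List.mem_finRange t)
  have hw : (∀ s ∈ A, s ≠ w) ∧ (∀ s ∈ B, s ≠ w) ∧ l ≠ w := by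
    simp only [List.nodup_append, List.nodup_cons, List.mem_cons, List.mem_append] at hn
    grind
  have hcA : ∀ s ∈ A, Function.update len w (len w - len l) s = len s := fun s hs =>
    Function.update_of_ne (hw.1 s hs) _ _
  have hcB : ∀ s ∈ B, Function.update len w (len w - len l) s = len s := fun s hs =>
    Function.update_of_ne (hw.2.1 s hs) _ _
  by_cases h : t ∈ A
  · rw [offset_append_of_mem _ _ h, offset_append_of_mem _ _ h, offset_congr t hcA]
  · rw [offset_append_of_not_mem _ _ h, offset_append_of_not_mem _ _ h, List.map_congr_left hcA,
      offset_cons, offset_cons, offset_cons, if_neg (Ne.symm ht)]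
    by_cases htw : w = t
    · simp [htw]
    · have hB : t ∈ B := by
        simp only [List.mem_append, List.mem_cons] at hm
        grind
      rw [if_neg htw, if_neg htw, offset_append_of_mem _ _ hB, offset_congr t hcB,
        Function.update_self, Function.update_of_ne hw.2.2]
      ring

theorem offset_insert_self {A B : List (Fin n)} {w l : Fin n}
    (hP : (A ++ w :: (B ++ [l])).Perm (List.finRange n)) (len : Fin n → ℝ) :
    offset (A ++ w :: l :: B) (Function.update len w (len w - len l)) l
      = offset (A ++ w :: (B ++ [l])) len w + len w - len l := by
  have hn := hP.nodup_iff.2 (List.nodup_finRange n)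
  have hw : (∀ s ∈ A, s ≠ w) ∧ l ≠ w ∧ l ∉ A ∧ w ∉ A := by
    simp only [List.nodup_append, List.nodup_cons, List.mem_cons, List.mem_append] at hn
    grind
  have hcA : ∀ s ∈ A, Function.update len w (len w - len l) s = len s := fun s hs =>
    Function.update_of_ne (hw.1 s hs) _ _
  rw [offset_append_of_not_mem _ _ hw.2.2.1, offset_append_of_not_mem _ _ hw.2.2.2,
    List.map_congr_left hcA]
  simp only [offset_cons, if_true, if_neg hw.2.1.symm, Function.update_self]
  ring

/-- That the intervals of a row tile the total interval is expressed by counting functions; in this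
form it adds up over the floors of towers. -/
theorem sum_indicator_row {L : List (Fin n)} (hL : L.Nodup) {len : Fin n → ℝ}
    (hpos : ∀ t, 0 < len t) (x : ℝ) :
    (L.map fun t => (Set.Ico (offset L len t) (offset L len t + len t)).indicator
      (1 : ℝ → ℕ) x).sum = (Set.Ico 0 (L.map len).sum).indicator (1 : ℝ → ℕ) x := by
  induction L generalizing x with
  | nil => simp
  | cons b L ih =>
    rw [List.nodup_cons] at hL
    have h0 : ((L.map len).sum) ≥ 0 := by
      refine List.sum_nonneg fun y hy => ?_
      obtain ⟨t, -, rfl⟩ := List.mem_map.1 hy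
      exact (hpos t).le
    have hb := hpos b
    have h1 : (L.map fun t => (Set.Ico (offset (b :: L) len t)
        (offset (b :: L) len t + len t)).indicator (1 : ℝ → ℕ) x)
        = L.map fun t => (Set.Ico (offset L len t) (offset L len t + len t)).indicator
          (1 : ℝ → ℕ) (x - len b) := by
      refine List.map_congr_left fun t ht => ?_
      have hbt : b ≠ t := fun h => hL.1 (h ▸ ht)
      rw [offset_cons, if_neg hbt]
      simp only [Set.indicator_apply, Set.mem_Ico]
      congr 1
      apply propext
      constructor <;> rintro ⟨h1, h2⟩ <;> constructor <;> linarith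
    rw [List.map_cons, List.sum_cons, h1, ih hL.2, offset_cons, if_pos rfl, List.map_cons,
      List.sum_cons]
    simp only [Set.indicator_apply, Set.mem_Ico, Pi.one_apply]
    split_ifs with h2 h3 h4 h4 h3 h4 h4 <;> first | rfl | (exfalso; grind)

end Offset

namespace IETData

variable {n : ℕ}

/-- Both rows list every label once, and the lengths are positive. -/
structure Admissible (S : IETData n) : Prop where
  top_perm : S.pair.top.Perm (List.finRange n)
  bot_perm : S.pair.bot.Perm (List.finRange n)
  len_pos : ∀ t, 0 < S.len t

/-- The amount by which the exchange translates the interval with label `t`. -/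
def shift (S : IETData n) (t : Fin n) : ℝ :=
  offset S.pair.bot S.len t - offset S.pair.top S.len t

variable [NeZero n]

/-- The geometric content of a Rauzy step with winner `w` and loser `l`, where `p` is the last
label of the bottom row and `q` the last label of the top row: the new interval `l` lies in the
old interval `p`, whose image under the exchange meets the old interval `q`. -/
structure StepGeometry (S S' : IETData n) (w l p q : Fin n) : Prop where
  ne : w ≠ l
  cases : (p = l ∧ q = w) ∨ (p = w ∧ q = l)
  same : ∀ t, t ≠ w → t ≠ l → S'.interval t = S.interval t
  winner_subset : S'.interval w ⊆ S.interval w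
  loser_subset : S'.interval l ⊆ S.interval p
  image_subset : (fun x => x - S.shift p) ⁻¹' S'.interval l ⊆ S.interval q
  winner_zero : p = l → S.interval l = S'.interval l ∧
    S.interval w = S'.interval w ∪ (fun x => x - S.shift l) ⁻¹' S'.interval l ∧
    Disjoint (S'.interval w) ((fun x => x - S.shift l) ⁻¹' S'.interval l)
  winner_one : p = w → S.interval l = (fun x => x - S.shift w) ⁻¹' S'.interval l ∧
    S.interval w = S'.interval w ∪ S'.interval l ∧ Disjoint (S'.interval w) (S'.interval l)
  shift_of_ne : ∀ t, t ≠ l → S'.shift t = S.shift t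
  shift_loser : S'.shift l = S.shift p + S.shift q

/-- `Q` is the row that ends with the winner and `P` the other one; exchanging their roles serves
both types of steps. -/
theorem exists_row_decomp {P Q : List (Fin n)} (hP : P.Perm (List.finRange n))
    (hQ : Q.Perm (List.finRange n)) (hne : Q.getLastD 0 ≠ P.getLastD 0) :
    ∃ (w l : Fin n) (A B D : List (Fin n)), w ≠ l ∧ P = A ++ w :: (B ++ [l]) ∧ Q = D ++ [w] := by
  have hpos : 0 < n := NeZero.pos n
  have hP0 : P ≠ [] := by
    rintro rfl
    have := hP.length_eq
    simp at this; omega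
  have hQ0 : Q ≠ [] := by
    rintro rfl
    have := hQ.length_eq
    simp at this; omega
  have eP := List.dropLast_append_getLast hP0
  have eQ := List.dropLast_append_getLast hQ0
  set w := Q.getLast hQ0
  set l := P.getLast hP0
  have hwl : w ≠ l := by
    rw [← eP, ← eQ, List.getLastD_concat, List.getLastD_concat] at hne
    exact hne
  have hw : w ∈ P := hP.mem_iff.2 (List.mem_finRange w)
  rw [← eP, List.mem_append, List.mem_singleton] at hw
  obtain ⟨A, B, hAB⟩ := List.append_of_mem (hw.resolve_right hwl)
  refine ⟨w, l, A, B, Q.dropLast, hwl, ?_, eQ.symm⟩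
  rw [← eP, hAB]
  simp

/-- The step cuts off the right end of the total interval, over the loser's length. The points that
the exchange sends into this end form the new interval `l`; they lie in the last interval of the
bottom row and land in the last one of the top row. They need a second application to return, which
is why their displacement is the sum of two old ones. -/
theorem stepGeometry {S : IETData n} (hS : S.Admissible) {e : RauzyType} (he : S.HasType e) :
    (S.step e).Admissible ∧ StepGeometry S (S.step e) (S.pair.winner e) (S.pair.loser e)
      (S.pair.bot.getLastD 0) (S.pair.top.getLastD 0) := by
  obtain ⟨⟨top, bot⟩, len⟩ := S
  obtain ⟨ht, hb, hpos⟩ := hS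
  simp only at ht hb hpos
  have hne : (RauzyPair.mk top bot).winner e ≠ (RauzyPair.mk top bot).loser e := by
    intro h
    simp only [HasType, h, lt_self_iff_false] at he
  have hposS : ∀ t, 0 < (step ⟨⟨top, bot⟩, len⟩ e).len t := by
    intro t
    simp only [step]
    by_cases h : t = (RauzyPair.mk top bot).winner e
    · subst h
      rw [Function.update_self]
      exact sub_pos.2 he
    · rw [Function.update_of_ne h]; exact hpos t
  cases e with
  | zero =>
    obtain ⟨w, l, A, B, D, hwl, rfl, rfl⟩ := exists_row_decomp hb ht hne
    have hn := hb.nodup_iff.2 (List.nodup_finRange n)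
    have hw : w ∉ A ∧ w ∉ B := by
      simp only [List.nodup_append, List.nodup_cons, List.mem_cons, List.mem_append] at hn
      grind
    have eb : A ++ w :: (B ++ [l]) = (A ++ w :: B) ++ [l] := by simp
    have ew : RauzyPair.winner ⟨D ++ [w], A ++ w :: (B ++ [l])⟩ .zero = w := by
      simp only [RauzyPair.winner, List.getLastD_concat]
    have el : RauzyPair.loser ⟨D ++ [w], A ++ w :: (B ++ [l])⟩ .zero = l := by
      simp only [eb, RauzyPair.loser, List.getLastD_concat]
    have es : step ⟨⟨D ++ [w], A ++ w :: (B ++ [l])⟩, len⟩ .zero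
        = ⟨⟨D ++ [w], A ++ w :: l :: B⟩, Function.update len w (len w - len l)⟩ := by
      simp only [step, ew, el, RauzyPair.move]
      rw [eb, List.dropLast_concat, insertAfter_middle hw.1 hw.2]
    simp only [HasType, ew, el] at he
    rw [es] at hposS ⊢
    rw [ew, el, show (A ++ w :: (B ++ [l])).getLastD 0 = l by rw [eb, List.getLastD_concat],
      List.getLastD_concat]
    have hperm : (A ++ w :: l :: B).Perm (List.finRange n) :=
      (List.Perm.append_left _ (List.Perm.cons _ (List.perm_append_singleton l B).symm)).trans hb
    have t1 := offset_shorten_last ht len (len w - len l)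
    have t2 := offset_last ht len
    have b1 := fun t (h : t ≠ l) => offset_insert hb len h
    have b2 := offset_insert_self hb len
    have b3 : offset (A ++ w :: (B ++ [l])) len l = ∑ t, len t - len l := by
      rw [eb]; exact offset_last (by rwa [← eb]) len
    have hl := hpos l
    have u1 : Function.update len w (len w - len l) w = len w - len l := Function.update_self ..
    have u2 : ∀ t, t ≠ w → Function.update len w (len w - len l) t = len t := fun t h =>
      Function.update_of_ne h ..
    have u3 := u2 l hwl.symm
    refine ⟨⟨ht, hperm, hposS⟩, hwl, Or.inl ⟨rfl, rfl⟩, ?_, ?_, ?_, ?_, ?_, ?_, ?_, ?_⟩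
    · intro t h1 h2
      simp only [interval, t1, u2 t h1]
    · intro x
      simp only [interval, Set.mem_Ico, t1, u1]
      rintro ⟨h1, h2⟩
      constructor <;> linarith
    · simp only [interval, t1, u3]
      exact subset_rfl
    · intro x
      simp only [interval, shift, Set.mem_Ico, Set.mem_preimage, t1, u3, t2, b3]
      rintro ⟨h1, h2⟩
      constructor <;> linarith
    · intro _
      refine ⟨by simp only [interval, t1, u3], ?_, ?_⟩
      · ext x
        simp only [interval, shift, Set.mem_Ico, Set.mem_preimage, Set.mem_union, t1, u1, u3, t2,
          b3]
        constructor
        · rintro ⟨h1, h2⟩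
          rcases lt_or_ge x (∑ t, len t - len l) with h | h
          · left; constructor <;> linarith
          · right; constructor <;> linarith
        · rintro (⟨h1, h2⟩ | ⟨h1, h2⟩) <;> constructor <;> linarith
      · rw [Set.disjoint_left]
        intro x
        simp only [interval, shift, Set.mem_Ico, Set.mem_preimage, t1, u1, u3, t2, b3]
        rintro ⟨h1, h2⟩ ⟨h3, h4⟩
        linarith
    · exact fun h => absurd h hwl.symm
    · intro t h
      simp only [shift, t1, b1 t h]
    · simp only [shift, t1, b2, b3, t2]
      ring
  | one =>
    obtain ⟨w, l, A, B, D, hwl, rfl, rfl⟩ := exists_row_decomp ht hb hne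
    have hn := ht.nodup_iff.2 (List.nodup_finRange n)
    have hw : w ∉ A ∧ w ∉ B := by
      simp only [List.nodup_append, List.nodup_cons, List.mem_cons, List.mem_append] at hn
      grind
    have eb : A ++ w :: (B ++ [l]) = (A ++ w :: B) ++ [l] := by simp
    have ew : RauzyPair.winner ⟨A ++ w :: (B ++ [l]), D ++ [w]⟩ .one = w := by
      simp only [RauzyPair.winner, List.getLastD_concat]
    have el : RauzyPair.loser ⟨A ++ w :: (B ++ [l]), D ++ [w]⟩ .one = l := by
      simp only [eb, RauzyPair.loser, List.getLastD_concat]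
    have es : step ⟨⟨A ++ w :: (B ++ [l]), D ++ [w]⟩, len⟩ .one
        = ⟨⟨A ++ w :: l :: B, D ++ [w]⟩, Function.update len w (len w - len l)⟩ := by
      simp only [step, ew, el, RauzyPair.move]
      rw [eb, List.dropLast_concat, insertAfter_middle hw.1 hw.2]
    simp only [HasType, ew, el] at he
    rw [es] at hposS ⊢
    rw [ew, el, show (A ++ w :: (B ++ [l])).getLastD 0 = l by rw [eb, List.getLastD_concat],
      List.getLastD_concat]
    have hperm : (A ++ w :: l :: B).Perm (List.finRange n) :=
      (List.Perm.append_left _ (List.Perm.cons _ (List.perm_append_singleton l B).symm)).trans ht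
    have b1 := offset_shorten_last hb len (len w - len l)
    have b2 := offset_last hb len
    have t1 := fun t (h : t ≠ l) => offset_insert ht len h
    have t2 := offset_insert_self ht len
    have t3 : offset (A ++ w :: (B ++ [l])) len l = ∑ t, len t - len l := by
      rw [eb]; exact offset_last (by rwa [← eb]) len
    have tw := t1 w hwl
    have hl := hpos l
    have u1 : Function.update len w (len w - len l) w = len w - len l := Function.update_self ..
    have u2 : ∀ t, t ≠ w → Function.update len w (len w - len l) t = len t := fun t h =>
      Function.update_of_ne h ..
    have u3 := u2 l hwl.symm
    refine ⟨⟨hperm, hb, hposS⟩, hwl, Or.inr ⟨rfl, rfl⟩, ?_, ?_, ?_, ?_, ?_, ?_, ?_, ?_⟩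
    · intro t h1 h2
      simp only [interval, t1 t h2, u2 t h1]
    · intro x
      simp only [interval, Set.mem_Ico, tw, u1]
      rintro ⟨h1, h2⟩
      constructor <;> linarith
    · intro x
      simp only [interval, Set.mem_Ico, t2, u3]
      rintro ⟨h1, h2⟩
      constructor <;> linarith
    · intro x
      simp only [interval, shift, Set.mem_Ico, Set.mem_preimage, t2, u3, t3, b2]
      rintro ⟨h1, h2⟩
      constructor <;> linarith
    · exact fun h => absurd h hwl
    · intro _
      refine ⟨?_, ?_, ?_⟩
      · ext x
        simp only [interval, shift, Set.mem_Ico, Set.mem_preimage, t2, u3, t3, b2]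
        constructor <;> rintro ⟨h1, h2⟩ <;> constructor <;> linarith
      · ext x
        simp only [interval, Set.mem_Ico, Set.mem_union, t2, tw, u1, u3]
        constructor
        · rintro ⟨h1, h2⟩
          rcases lt_or_ge x (offset (A ++ w :: (B ++ [l])) len w + len w - len l) with h | h
          · left; constructor <;> linarith
          · right; constructor <;> linarith
        · rintro (⟨h1, h2⟩ | ⟨h1, h2⟩) <;> constructor <;> linarith
      · rw [Set.disjoint_left]
        intro x
        simp only [interval, Set.mem_Ico, t2, tw, u1, u3]
        rintro ⟨h1, h2⟩ ⟨h3, h4⟩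
        linarith
    · intro t h
      simp only [shift, b1, t1 t h]
    · simp only [shift, b1, b2, t2, t3]
      ring

end IETData

/-! ### Towers over an induced exchange -/

namespace IETData

variable {n : ℕ}

/-- The number of floors of the towers over `S` that contain `x`, where the floors over the interval
`t` are its translates by the entries of the list `fl t`. -/
def towerCount (S : IETData n) (fl : Fin n → List ℝ) (x : ℝ) : ℕ :=
  ∑ t, ((fl t).map fun s => (S.interval t).indicator (1 : ℝ → ℕ) (x - s)).sum

/-- The measure `μ` is invariant under the exchange on each interval, and under the translations
of each interval to the floors of its tower. -/
structure TransInvariant (S : IETData n) (fl : Fin n → List ℝ) (μ : Measure ℝ) : Prop where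
  shift_inv : ∀ t, ∀ A ⊆ S.interval t, MeasurableSet A →
    μ ((fun x => x - S.shift t) ⁻¹' A) = μ A
  floor_inv : ∀ t, ∀ s ∈ fl t, ∀ A ⊆ S.interval t, MeasurableSet A →
    μ ((fun x => x - s) ⁻¹' A) = μ A

theorem measurableSet_interval (S : IETData n) (t : Fin n) : MeasurableSet (S.interval t) :=
  measurableSet_Ico

theorem measurableSet_preimage_sub {A : Set ℝ} (hA : MeasurableSet A) (s : ℝ) :
    MeasurableSet ((fun x => x - s) ⁻¹' A) := hA.preimage (measurable_id.sub_const s)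

theorem sum_eq_of_two {f g : Fin n → ℕ} {w l : Fin n} (hwl : w ≠ l)
    (h : ∀ t, t ≠ w → t ≠ l → f t = g t) (h2 : f w + f l = g w + g l) : ∑ t, f t = ∑ t, g t := by
  have key : ∀ u : Fin n → ℕ, ∑ t, u t = u w + u l + ∑ t ∈ (Finset.univ.erase w).erase l, u t := by
    intro u
    rw [← Finset.add_sum_erase _ _ (Finset.mem_univ w),
      ← Finset.add_sum_erase (Finset.univ.erase w) u (a := l) (by simp [hwl.symm]), add_assoc]
  rw [key f, key g, h2]
  congr 1
  refine Finset.sum_congr rfl fun t ht => ?_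
  simp only [Finset.mem_erase, Finset.mem_univ, and_true] at ht
  exact h t ht.2 ht.1

theorem sum_map_add' {L : List ℝ} (f g : ℝ → ℕ) :
    (L.map fun s => f s + g s).sum = (L.map f).sum + (L.map g).sum := by
  induction L with
  | nil => rfl
  | cons b L ih => simp only [List.map_cons, List.sum_cons, ih]; ring

theorem indicator_split {I J K : Set ℝ} (h : I = J ∪ K) (hd : Disjoint J K) (x : ℝ) :
    I.indicator (1 : ℝ → ℕ) x = J.indicator 1 x + K.indicator 1 x := by
  rw [h, Set.indicator_union_of_disjoint hd]

theorem sum_indicator_top {S : IETData n} (hS : S.Admissible) (x : ℝ) :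
    ∑ t, (S.interval t).indicator (1 : ℝ → ℕ) x
      = (Set.Ico 0 (∑ t, S.len t)).indicator 1 x := by
  have h := sum_indicator_row (hS.top_perm.nodup_iff.2 (List.nodup_finRange n)) hS.len_pos x
  rw [sum_map_perm hS.top_perm, (hS.top_perm.map _).sum_eq, ← Fin.sum_univ_def] at h
  exact h

theorem sum_indicator_bot {S : IETData n} (hS : S.Admissible) (x : ℝ) :
    ∑ t, (S.interval t).indicator (1 : ℝ → ℕ) (x - S.shift t)
      = (Set.Ico 0 (∑ t, S.len t)).indicator 1 x := by
  have h := sum_indicator_row (hS.bot_perm.nodup_iff.2 (List.nodup_finRange n)) hS.len_pos x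
  rw [sum_map_perm hS.bot_perm, (hS.bot_perm.map _).sum_eq, ← Fin.sum_univ_def] at h
  rw [← h]
  refine Finset.sum_congr rfl fun t _ => ?_
  simp only [Set.indicator_apply, Set.mem_Ico, interval, shift]
  congr 1
  apply propext
  constructor <;> rintro ⟨h1, h2⟩ <;> constructor <;> linarith

theorem eq_of_sum_indicator_le {ι : Type*} [Fintype ι] {I : ι → Set ℝ} {y : ι → ℝ}
    (h : ∑ t, (I t).indicator (1 : ℝ → ℕ) (y t) ≤ 1) {s t : ι} (hs : y s ∈ I s) (ht : y t ∈ I t) :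
    s = t := by
  classical
  by_contra hst
  have : ∑ u ∈ ({s, t} : Finset ι), (I u).indicator (1 : ℝ → ℕ) (y u) ≤ 1 :=
    (Finset.sum_le_sum_of_subset (Finset.subset_univ _)).trans h
  rw [Finset.sum_pair hst, Set.indicator_of_mem hs, Set.indicator_of_mem ht] at this
  simp at this

theorem toFun_of_mem {S : IETData n} (hS : S.Admissible) {x : ℝ} {t : Fin n}
    (hx : x ∈ S.interval t) : S.toFun x = x + S.shift t := by
  unfold toFun
  congr 1
  rw [Finset.sum_eq_single t]
  · rw [Set.indicator_of_mem hx]; rfl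
  · intro s _ hst
    refine Set.indicator_of_notMem (fun hs => hst ?_) _
    refine eq_of_sum_indicator_le (I := S.interval) (y := fun _ => x) ?_ hs hx
    rw [sum_indicator_top hS]
    exact Set.indicator_apply_le' (by simp) (by simp)
  · simp

/-- Invariance gives information on preimages only. It passes to images of pieces of one interval
because the exchange is injective on `[0,1)`, and `μ` does not see the complement of `[0,1)`. -/
theorem transInvariant_initial {S : IETData n} (hS : S.Admissible) (hsum : ∑ t, S.len t = 1)
    {μ : Measure ℝ} (hc : μ (Set.Ico 0 1)ᶜ = 0) (hinv : MeasurePreserving S.toFun μ μ) :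
    S.TransInvariant (fun _ => [0]) μ := by
  constructor
  · intro t A hA hm
    have hB := measurableSet_preimage_sub hm (S.shift t)
    rw [← hinv.measure_preimage hB.nullMeasurableSet]
    have hAe : A ∩ Set.Ico 0 1
        = S.toFun ⁻¹' ((fun x => x - S.shift t) ⁻¹' A) ∩ Set.Ico 0 1 := by
      ext x
      simp only [Set.mem_inter_iff, Set.mem_preimage, and_congr_left_iff]
      intro hx
      obtain ⟨s, hs⟩ : ∃ s, x ∈ S.interval s := by
        by_contra! hno
        have := sum_indicator_top hS x
        rw [hsum, Set.indicator_of_mem hx,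
          Finset.sum_eq_zero fun s _ => Set.indicator_of_notMem (hno s) _] at this
        simp at this
      rw [toFun_of_mem hS hs]
      constructor
      · intro hxA
        have : s = t := by
          refine eq_of_sum_indicator_le (I := S.interval) (y := fun _ => x) ?_ hs (hA hxA)
          rw [sum_indicator_top hS]
          exact Set.indicator_apply_le' (by simp) (by simp)
        subst this
        simpa using hxA
      · intro hxA
        -- Here the bottom row enters: images of distinct intervals are disjoint.
        have : s = t := by
          refine eq_of_sum_indicator_le (I := S.interval)
            (y := fun u => (x + S.shift s) - S.shift u) ?_ (by simpa using hs) (hA hxA)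
          rw [sum_indicator_bot hS]
          exact Set.indicator_apply_le' (by simp) (by simp)
        subst this
        simpa using hxA
    have hr : ∀ B : Set ℝ, μ B = μ (B ∩ Set.Ico 0 1) := fun B =>
      (measure_inter_conull hc).symm
    rw [hr A, hAe, ← hr]
  · intro t s hs A _ _
    rw [List.mem_singleton] at hs
    subst hs
    simp

variable [NeZero n]

/-- The floors after a Rauzy step. -/
def stepFloors (S : IETData n) (e : RauzyType) (fl : Fin n → List ℝ) : Fin n → List ℝ :=
  Function.update fl (S.pair.loser e) (fl (S.pair.bot.getLastD 0) ++
    (fl (S.pair.top.getLastD 0)).map fun s => S.shift (S.pair.bot.getLastD 0) + s)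

/-- Cutting and stacking: the winner's tower is split vertically and one part is stacked with the
loser's tower, so every point keeps its number of floors. -/
theorem towerCount_step {S : IETData n} (hS : S.Admissible) {e : RauzyType} (he : S.HasType e)
    (fl : Fin n → List ℝ) (x : ℝ) :
    (S.step e).towerCount (S.stepFloors e fl) x = S.towerCount fl x := by
  obtain ⟨-, hg⟩ := stepGeometry hS he
  unfold stepFloors
  set w := S.pair.winner e
  set l := S.pair.loser e
  set p := S.pair.bot.getLastD 0
  set q := S.pair.top.getLastD 0
  set S' := S.step e
  refine sum_eq_of_two hg.ne (fun t h1 h2 => ?_) ?_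
  · simp only [Function.update_of_ne h2, hg.same t h1 h2]
  · simp only [Function.update_self, Function.update_of_ne hg.ne, List.map_append, List.sum_append,
      List.map_map, Function.comp_def]
    have hpre : ∀ (d s : ℝ), ((fun x => x - d) ⁻¹' S'.interval l).indicator (1 : ℝ → ℕ) (x - s)
        = (S'.interval l).indicator 1 (x - (d + s)) := by
      intro d s
      rw [show x - (d + s) = (x - s) - d by ring]
      rfl
    rcases hg.cases with ⟨hp, hq⟩ | ⟨hp, hq⟩
    · obtain ⟨h1, h2, h3⟩ := hg.winner_zero hp
      have e1 : ((fl w).map fun s => (S.interval w).indicator (1 : ℝ → ℕ) (x - s)).sum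
          = ((fl w).map fun s => (S'.interval w).indicator (1 : ℝ → ℕ) (x - s)).sum
            + ((fl w).map fun s => (S'.interval l).indicator (1 : ℝ → ℕ)
                (x - (S.shift l + s))).sum := by
        rw [← sum_map_add']
        congr 1
        refine List.map_congr_left fun s _ => ?_
        rw [indicator_split h2 h3, hpre]
      rw [hp, hq, e1, h1]
      ring
    · obtain ⟨h1, h2, h3⟩ := hg.winner_one hp
      have e1 : ((fl w).map fun s => (S.interval w).indicator (1 : ℝ → ℕ) (x - s)).sum
          = ((fl w).map fun s => (S'.interval w).indicator (1 : ℝ → ℕ) (x - s)).sum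
            + ((fl w).map fun s => (S'.interval l).indicator (1 : ℝ → ℕ) (x - s)).sum := by
        rw [← sum_map_add']
        congr 1
        refine List.map_congr_left fun s _ => ?_
        rw [indicator_split h2 h3]
      have e2 : ((fl l).map fun s => (S.interval l).indicator (1 : ℝ → ℕ) (x - s)).sum
          = ((fl l).map fun s => (S'.interval l).indicator (1 : ℝ → ℕ)
                (x - (S.shift w + s))).sum := by
        congr 1
        refine List.map_congr_left fun s _ => ?_
        rw [h1, hpre]
      rw [hp, hq, e1, e2]
      ring

/-- A translation over the new loser is an old one over `p`, or the shift of `p` followed by an old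
one over `q`; each factor preserves `μ` on the set that it meets. -/
theorem TransInvariant.step {S : IETData n} (hS : S.Admissible) {e : RauzyType}
    (he : S.HasType e) {fl : Fin n → List ℝ} {μ : Measure ℝ} (hμ : S.TransInvariant fl μ) :
    (S.step e).TransInvariant (S.stepFloors e fl) μ := by
  obtain ⟨-, hg⟩ := stepGeometry hS he
  unfold stepFloors
  set w := S.pair.winner e
  set l := S.pair.loser e
  set p := S.pair.bot.getLastD 0
  set q := S.pair.top.getLastD 0
  set S' := S.step e
  have hsub : ∀ t, t ≠ l → S'.interval t ⊆ S.interval t := by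
    intro t ht
    by_cases h : t = w
    · rw [h]; exact hg.winner_subset
    · rw [hg.same t h ht]
  have hcomp : ∀ A : Set ℝ, A ⊆ S'.interval l → MeasurableSet A →
      (fun x => x - S.shift p) ⁻¹' A ⊆ S.interval q ∧
      μ ((fun x => x - S.shift p) ⁻¹' A) = μ A := fun A hA hm =>
    ⟨(Set.preimage_mono hA).trans hg.image_subset,
      hμ.shift_inv p A (hA.trans hg.loser_subset) hm⟩
  constructor
  · intro t A hA hm
    by_cases ht : t = l
    · subst ht
      obtain ⟨h1, h2⟩ := hcomp A hA hm
      rw [hg.shift_loser, ← h2, ← hμ.shift_inv q _ h1 (measurableSet_preimage_sub hm _)]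
      congr 1
      ext x
      simp only [Set.mem_preimage]
      rw [show x - (S.shift p + S.shift q) = x - S.shift q - S.shift p by ring]
    · rw [hg.shift_of_ne t ht]
      exact hμ.shift_inv t A (hA.trans (hsub t ht)) hm
  · intro t s hs A hA hm
    by_cases ht : t = l
    · subst ht
      rw [Function.update_self, List.mem_append, List.mem_map] at hs
      rcases hs with hs | ⟨s, hs, rfl⟩
      · exact hμ.floor_inv p s hs A (hA.trans hg.loser_subset) hm
      · obtain ⟨h1, h2⟩ := hcomp A hA hm
        rw [← h2, ← hμ.floor_inv q s hs _ h1 (measurableSet_preimage_sub hm _)]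
        congr 1
        ext x
        simp only [Set.mem_preimage]
        rw [show x - (S.shift p + s) = x - s - S.shift p by ring]
    · rw [Function.update_of_ne ht] at hs
      exact hμ.floor_inv t s hs A (hA.trans (hsub t ht)) hm

theorem measure_step {S : IETData n} (hS : S.Admissible) {e : RauzyType}
    (he : S.HasType e) {fl : Fin n → List ℝ} {μ : Measure ℝ} [IsFiniteMeasure μ]
    (hμ : S.TransInvariant fl μ) :
    (fun t => μ.real (S.interval t)) = Matrix.mulVec
      ((1 + Matrix.single (S.pair.winner e) (S.pair.loser e) (1 : ℕ)).map (Nat.cast : ℕ → ℝ))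
      (fun t => μ.real ((S.step e).interval t)) := by
  obtain ⟨-, hg⟩ := stepGeometry hS he
  set w := S.pair.winner e
  set l := S.pair.loser e
  set S' := S.step e
  have hinv : ∀ t, S'.interval l ⊆ S.interval t →
      μ.real ((fun x => x - S.shift t) ⁻¹' S'.interval l) = μ.real (S'.interval l) := fun t h => by
    rw [measureReal_def, hμ.shift_inv t _ h (S'.measurableSet_interval l)]; rfl
  have hfacts : μ.real (S.interval l) = μ.real (S'.interval l) ∧
      μ.real (S.interval w) = μ.real (S'.interval w) + μ.real (S'.interval l) := by
    rcases hg.cases with ⟨hp, hq⟩ | ⟨hp, hq⟩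
    · obtain ⟨h1, h2, h3⟩ := hg.winner_zero hp
      refine ⟨by rw [h1], ?_⟩
      rw [h2, measureReal_union h3 (measurableSet_preimage_sub (S'.measurableSet_interval l) _),
        hinv l (by rw [h1])]
    · obtain ⟨h1, h2, h3⟩ := hg.winner_one hp
      refine ⟨?_, by rw [h2, measureReal_union h3 (S'.measurableSet_interval l)]⟩
      rw [h1, hinv w (h2 ▸ Set.subset_union_right)]
  have hm : ((1 + Matrix.single w l (1 : ℕ)).map (Nat.cast : ℕ → ℝ))
      = 1 + Matrix.single w l (1 : ℝ) := by
    ext i j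
    simp [Matrix.single_apply, Matrix.one_apply]
  rw [hm, Matrix.add_mulVec, Matrix.one_mulVec]
  funext t
  by_cases ht : t = w
  · subst ht
    simp [hfacts.2, Matrix.mulVec, dotProduct, Matrix.single_apply]
  · have : μ.real (S.interval t) = μ.real (S'.interval t) := by
      by_cases htl : t = l
      · rw [htl, hfacts.1]
      · rw [hg.same t ht htl]
    simp [this, Matrix.mulVec, dotProduct, Ne.symm ht]

/-- Towers exist along any admissible path, with heights given by `track`, and the path matrix
carries the new interval measures to the old ones. The determinant is recorded because inverting the
matrices later transfers a limit from stage `0` to stage `k`. -/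
theorem exists_floors_run (w : List RauzyType) {S : IETData n} (hS : S.Admissible)
    (hw : S.Follows w) (fl : Fin n → List ℝ) :
    (S.run w).Admissible ∧
    ((S.pair.pathMatrix w).map (Nat.cast : ℕ → ℝ)).det = 1 ∧
    ∃ fl' : Fin n → List ℝ, (∀ x, (S.run w).towerCount fl' x = S.towerCount fl x) ∧
      (fun t => (fl' t).length) = (track (S.pair, fun t => (fl t).length) w).2 ∧
      ∀ μ : Measure ℝ, IsFiniteMeasure μ → S.TransInvariant fl μ →
        (S.run w).TransInvariant fl' μ ∧
        (fun t => μ.real (S.interval t)) = Matrix.mulVec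
          ((S.pair.pathMatrix w).map (Nat.cast : ℕ → ℝ))
          (fun t => μ.real ((S.run w).interval t)) := by
  induction w generalizing S fl with
  | nil =>
    refine ⟨hS, by simp [RauzyPair.pathMatrix], fl, fun _ => rfl, rfl, fun μ _ h => ⟨h, ?_⟩⟩
    simp [RauzyPair.pathMatrix, run]
  | cons e w ih =>
    obtain ⟨he, hw⟩ := hw
    obtain ⟨hS', hg⟩ := stepGeometry hS he
    obtain ⟨h1, hdet, fl', h2, h3, h4⟩ := ih hS' hw (S.stepFloors e fl)
    have hmul : (S.pair.pathMatrix (e :: w)).map (Nat.cast : ℕ → ℝ)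
        = ((1 + Matrix.single (S.pair.winner e) (S.pair.loser e) (1 : ℕ)).map (Nat.cast : ℕ → ℝ))
          * ((S.step e).pair.pathMatrix w).map (Nat.cast : ℕ → ℝ) := by
      rw [RauzyPair.pathMatrix]
      exact Matrix.map_mul (f := Nat.castRingHom ℝ)
    refine ⟨h1, ?_, fl', fun x => (h2 x).trans (towerCount_step hS he fl x), ?_, ?_⟩
    · rw [hmul, Matrix.det_mul, hdet, mul_one]
      have := Matrix.det_transvection_of_ne (R := ℝ) _ _ hg.ne 1
      rw [← this]
      congr 1
      ext i j
      simp [Matrix.transvection, Matrix.single_apply, Matrix.one_apply]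
    · rw [track_cons]
      rw [h3]
      congr 2
      refine Prod.ext rfl ?_
      funext t
      simp only [advance, stepFloors]
      by_cases ht : t = S.pair.loser e
      · subst ht
        simp only [Function.update_self, List.length_append, List.length_map]
        rcases hg.cases with ⟨hp, hq⟩ | ⟨hp, hq⟩
        · rw [hp, hq]
        · rw [hp, hq, add_comm]
      · simp only [Function.update_of_ne ht]
    · intro μ hfin hμ
      obtain ⟨h5, h6⟩ := h4 μ hfin (hμ.step hS he)
      refine ⟨h5, ?_⟩
      rw [measure_step hS he hμ, h6, hmul, Matrix.mulVec_mulVec]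
      rfl

end IETData

/-! ### Hausdorff dimension of a measure that is carried by towers -/

section Towers

/-- The union of the floors of a tower. -/
def tower (I : Set ℝ) (F : List ℝ) : Set ℝ := {x | ∃ s ∈ F, x - s ∈ I}

/-- The translates of the half-open interval `I` by the entries of `F` are disjoint subsets of
`[0, 1)`. -/
structure IsTower (I : Set ℝ) (F : List ℝ) : Prop where
  exists_Ico : ∃ lo hi, lo < hi ∧ I = Set.Ico lo hi
  count_le : ∀ x, (F.map fun s => I.indicator (1 : ℝ → ℕ) (x - s)).sum
    ≤ (Set.Ico (0 : ℝ) 1).indicator 1 x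

/-- All floors of the tower have the same measure. -/
def FloorInvariant (I : Set ℝ) (F : List ℝ) (μ : Measure ℝ) : Prop :=
  ∀ s ∈ F, μ ((fun x => x - s) ⁻¹' I) = μ I

variable {I : Set ℝ} {F : List ℝ}

theorem tower_cons (s : ℝ) : tower I (s :: F) = (fun x => x - s) ⁻¹' I ∪ tower I F := by
  ext x
  simp [tower]

theorem IsTower.measurableSet (h : IsTower I F) : MeasurableSet I := by
  obtain ⟨lo, hi, -, rfl⟩ := h.exists_Ico
  exact measurableSet_Ico

theorem measurableSet_tower (hI : MeasurableSet I) : MeasurableSet (tower I F) := by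
  induction F with
  | nil => simp [tower]
  | cons s F ih => rw [tower_cons]; exact (hI.preimage (measurable_id.sub_const s)).union ih

theorem one_le_count_of_mem {x : ℝ} (h : x ∈ tower I F) :
    1 ≤ (F.map fun s => I.indicator (1 : ℝ → ℕ) (x - s)).sum := by
  obtain ⟨s, hs, hx⟩ := h
  have := List.single_le_sum (l := F.map fun s => I.indicator (1 : ℝ → ℕ) (x - s)) (by simp) _
    (List.mem_map.2 ⟨s, hs, rfl⟩)
  rwa [Set.indicator_of_mem hx] at this

theorem IsTower.tail {s : ℝ} (h : IsTower I (s :: F)) : IsTower I F := by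
  refine ⟨h.exists_Ico, fun x => le_trans ?_ (h.count_le x)⟩
  simp

theorem IsTower.disjoint {s : ℝ} (h : IsTower I (s :: F)) :
    Disjoint ((fun x => x - s) ⁻¹' I) (tower I F) := by
  rw [Set.disjoint_left]
  intro x hx hx'
  have h1 := one_le_count_of_mem hx'
  have h2 := h.count_le x
  rw [List.map_cons, List.sum_cons, Set.indicator_of_mem (show x - s ∈ I from hx)] at h2
  have h3 : (Set.Ico (0 : ℝ) 1).indicator (1 : ℝ → ℕ) x ≤ 1 :=
    Set.indicator_apply_le' (by simp) (by simp)
  simp only [Pi.one_apply] at h2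
  omega

theorem IsTower.subset (h : IsTower I F) : tower I F ⊆ Set.Ico 0 1 := by
  intro x hx
  by_contra hn
  have := (one_le_count_of_mem hx).trans (h.count_le x)
  rw [Set.indicator_of_notMem hn] at this
  omega

theorem measure_tower (h : IsTower I F) {μ : Measure ℝ} (hμ : FloorInvariant I F μ) :
    μ (tower I F) = F.length * μ I := by
  induction F with
  | nil => simp [tower]
  | cons s F ih =>
    rw [tower_cons, measure_union h.disjoint (measurableSet_tower h.measurableSet),
      hμ s List.mem_cons_self, ih h.tail fun t ht => hμ t (List.mem_cons_of_mem _ ht)]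
    simp only [List.length_cons, Nat.cast_add, Nat.cast_one]
    ring

theorem IsTower.eq_of_mem (h : IsTower I F) {s t x : ℝ} (hs : s ∈ F) (ht : t ∈ F)
    (h1 : x - s ∈ I) (h2 : x - t ∈ I) : s = t := by
  induction F with
  | nil => simp at hs
  | cons u F ih =>
    have hd := Set.disjoint_left.1 h.disjoint
    rcases List.mem_cons.1 hs with rfl | hs'
    · rcases List.mem_cons.1 ht with rfl | ht'
      · rfl
      · exact absurd ⟨t, ht', h2⟩ (hd h1)
    · rcases List.mem_cons.1 ht with rfl | ht'
      · exact absurd ⟨s, hs', h1⟩ (hd h2)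
      · exact ih h.tail hs' ht'

/-- If `U` met three floors, the middle one would lie between two points of `U`, and the
`ν`-diameter of `U` would be at least `ν I`. -/
theorem measure_inter_tower_le (h : IsTower I F) {μ ν : Measure ℝ} (hμ : FloorInvariant I F μ)
    (hν : FloorInvariant I F ν) {U : Set ℝ} (hU : diamOf (measureDist ν) U < ν I) :
    μ (U ∩ tower I F) ≤ 2 * μ I := by
  classical
  obtain ⟨lo, hi, hlt, hI⟩ := h.exists_Ico
  set G : Finset ℝ := F.toFinset.filter fun s => ∃ x ∈ U, x - s ∈ I with hG
  have hGF : ∀ s ∈ G, s ∈ F ∧ ∃ x ∈ U, x - s ∈ I := fun s hs => by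
    simpa [hG] using hs
  have hsep : ∀ s ∈ F, ∀ t ∈ F, s < t → hi + s ≤ lo + t := by
    intro s hs t ht hst
    by_contra! hc
    refine hst.ne (h.eq_of_mem (x := lo + t) hs ht ?_ ?_)
    · rw [hI]; constructor <;> linarith
    · rw [hI]; constructor <;> linarith
  have hcard : G.card ≤ 2 := by
    by_contra! hc
    have hne : G.Nonempty := Finset.card_pos.1 (by omega)
    obtain ⟨m, hm, hm'⟩ : ∃ m ∈ G, m ≠ G.min' hne ∧ m ≠ G.max' hne := by
      by_contra! hno
      have : G ⊆ {G.min' hne, G.max' hne} := by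
        intro m hm
        simp only [Finset.mem_insert, Finset.mem_singleton]
        by_cases h1 : m = G.min' hne
        · exact Or.inl h1
        · exact Or.inr (hno m hm h1)
      have := (Finset.card_le_card this).trans Finset.card_le_two
      omega
    obtain ⟨a1, x, hx, hx'⟩ := hGF _ (G.min'_mem hne)
    obtain ⟨a3, y, hy, hy'⟩ := hGF _ (G.max'_mem hne)
    obtain ⟨a2, -⟩ := hGF _ hm
    have b1 := hsep _ a1 _ a2 (lt_of_le_of_ne (G.min'_le m hm) hm'.1.symm)
    have b2 := hsep _ a2 _ a3 (lt_of_le_of_ne (G.le_max' m hm) hm'.2)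
    rw [hI, Set.mem_Ico] at hx' hy'
    have hsub : (fun x => x - m) ⁻¹' I ⊆ Set.uIcc x y := by
      intro u hu
      rw [hI, Set.mem_preimage, Set.mem_Ico] at hu
      rw [Set.uIcc_of_le (by linarith)]
      constructor <;> linarith
    have h1 : ν I ≤ diamOf (measureDist ν) U :=
      calc ν I = ν ((fun x => x - m) ⁻¹' I) := (hν m a2).symm
        _ ≤ measureDist ν x y := measure_mono hsub
        _ ≤ diamOf (measureDist ν) U := by
          unfold diamOf
          exact (le_iSup₂_of_le (f := fun y _ => measureDist ν x y) y hy le_rfl).trans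
            (le_iSup₂ (f := fun x _ => ⨆ y ∈ U, measureDist ν x y) x hx)
    exact absurd hU (not_lt.2 h1)
  have hsub : U ∩ tower I F ⊆ ⋃ s ∈ G, (fun x => x - s) ⁻¹' I := by
    rintro x ⟨hxU, s, hs, hx⟩
    simp only [Set.mem_iUnion]
    exact ⟨s, by simp only [hG, Finset.mem_filter, List.mem_toFinset]; exact ⟨hs, x, hxU, hx⟩, hx⟩
  calc μ (U ∩ tower I F) ≤ ∑ s ∈ G, μ ((fun x => x - s) ⁻¹' I) :=
        (measure_mono hsub).trans (measure_biUnion_finset_le _ _)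
    _ = ∑ s ∈ G, μ I := Finset.sum_congr rfl fun s hs => hμ s (hGF s hs).1
    _ = G.card * μ I := by rw [Finset.sum_const, nsmul_eq_mul]
    _ ≤ 2 * μ I := by gcongr; exact_mod_cast hcard

end Towers

/-! ### The two dimension estimates for abstract towers. -/

section Dimension

variable {I : ℕ → Set ℝ} {F : ℕ → List ℝ} {μ ν : Measure ℝ}

/-- Mass distribution principle on the points that lie in all late towers. The scales `ν (I k)` are
discrete, so a set is compared with the scale `k` just above its diameter and the scale `k + 1`
below it; `hratio` pays for that gap and for the factor `2`. -/
theorem le_measureDim_of_towers [IsProbabilityMeasure μ] [IsFiniteMeasure ν]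
    (hT : ∀ k, IsTower (I k) (F k)) (hμ : ∀ k, FloorInvariant (I k) (F k) μ)
    (hν : ∀ k, FloorInvariant (I k) (F k) ν) (hc : μ (Set.Ico (0 : ℝ) 1)ᶜ = 0)
    (hsum : ∑' k, μ (tower (I k) (F k))ᶜ ≠ ∞) (hpos : ∀ k, 0 < ν.real (I k))
    (hlim : Tendsto (fun k => ν.real (I k)) atTop (𝓝 0))
    (hratio : ∀ s s' : ℝ, 0 < s → s < s' →
      ∀ᶠ k in atTop, 2 * ν.real (I k) ^ s' ≤ ν.real (I (k + 1)) ^ s) :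
    liminf (fun k : ℕ => ((Real.logb (ν.real (I k)) (μ.real (I k)) : ℝ) : EReal)) atTop
      ≤ measureDim (Set.Ico (0 : ℝ) 1) (measureDist ν) μ := by
  refine le_iInf fun A => le_iInf fun hA => le_iInf fun hAm => le_iInf fun hA0 => ?_
  refine le_iInf fun z => le_iInf fun hz => le_iInf fun hH => ?_
  by_contra! hlt
  obtain ⟨z', hz1, hz2⟩ := EReal.lt_iff_exists_real_btwn.1 hlt
  have hzz : z < z' := EReal.coe_lt_coe_iff.1 hz1
  have hA1 : μ Aᶜ = 0 := by
    refine measure_mono_null (t := (Set.Ico (0 : ℝ) 1 \ A) ∪ (Set.Ico (0 : ℝ) 1)ᶜ) ?_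
      (measure_union_null hA0 hc)
    intro x hx
    by_cases h : x ∈ Set.Ico (0 : ℝ) 1
    · exact Or.inl ⟨h, hx⟩
    · exact Or.inr h
  -- Below the `liminf` one has `μ (I k) ≤ ν (I k) ^ z'`, the base being less than `1`; lowering the
  -- exponent to `z` absorbs the factor `2` and the passage to scale `k + 1`.
  have hev : ∀ᶠ k in atTop, 2 * μ.real (I k) ≤ ν.real (I (k + 1)) ^ z := by
    filter_upwards [hratio z z' hz hzz, eventually_lt_of_lt_liminf hz2,
      hlim.eventually (gt_mem_nhds one_pos)] with k h1 h2 h3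
    refine le_trans ?_ h1
    have h4 : z' < Real.logb (ν.real (I k)) (μ.real (I k)) := EReal.coe_lt_coe_iff.1 h2
    gcongr
    rcases (measureReal_nonneg (μ := μ) (s := I k)).eq_or_lt with h | h
    · rw [← h]; exact Real.rpow_nonneg (hpos k).le _
    · exact ((Real.lt_logb_iff_rpow_lt_of_base_lt_one (hpos k) h3 h).1 h4).le
  obtain ⟨k1, hk1, hk1'⟩ := ((eventually_atTop.1 hev).imp fun k hk => hk).elim
    fun k0 hk0 => (((ENNReal.tendsto_sum_nat_add _ hsum).eventually
      (gt_mem_nhds one_pos)).and (eventually_ge_atTop k0)).exists.imp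
        fun k hk => And.intro hk.1 fun q (hq : k ≤ q) => hk0 q (hk.2.trans hq)
  have hE : ∀ k ≥ k1, 2 * μ (I k) ≤ ν (I (k + 1)) ^ z := by
    intro k hk
    have := ENNReal.ofReal_le_ofReal (hk1' k hk)
    rwa [ENNReal.ofReal_mul (by norm_num), ← ENNReal.ofReal_rpow_of_pos (hpos _),
      ofReal_measureReal, ofReal_measureReal, ENNReal.ofReal_ofNat] at this
  -- `k1` was chosen with the tail sum of the complements below `1`, so `E` has positive measure.
  set E : Set ℝ := ⋂ k, tower (I (k + k1)) (F (k + k1)) with hEdef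
  have hE0 : μ Eᶜ < 1 := by
    rw [hEdef, Set.compl_iInter]
    exact (measure_iUnion_le _).trans_lt hk1
  have hEpos : 0 < μ E := by
    by_contra! h0
    have h1 : μ Set.univ ≤ μ E + μ Eᶜ := by
      rw [← Set.union_compl_self E]; exact measure_union_le _ _
    rw [measure_univ, le_antisymm h0 bot_le, zero_add] at h1
    exact absurd hE0 (not_lt.2 h1)
  have hνlim : Tendsto (fun k => ν (I (k + 1)) ^ z) atTop (𝓝 0) := by
    have h1 : Tendsto (fun k => ENNReal.ofReal (ν.real (I (k + 1)))) atTop (𝓝 0) := by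
      have := (ENNReal.continuous_ofReal.tendsto 0).comp (hlim.comp (tendsto_add_atTop_nat 1))
      rwa [ENNReal.ofReal_zero] at this
    have h2 := ((ENNReal.continuous_rpow_const (y := z)).tendsto 0).comp h1
    rw [ENNReal.zero_rpow_of_pos hz] at h2
    refine h2.congr fun k => ?_
    simp
  have hU : ∀ U : Set ℝ, diamOf (measureDist ν) U < ν (I k1) →
      μ (U ∩ E) ≤ diamOf (measureDist ν) U ^ z := by
    intro U hUd
    set δ := diamOf (measureDist ν) U
    have hstep : ∀ k ≥ k1, δ < ν (I k) → μ (U ∩ E) ≤ ν (I (k + 1)) ^ z := by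
      intro k hk hδ
      refine le_trans (le_trans (measure_mono ?_)
        (measure_inter_tower_le (hT k) (hμ k) (hν k) hδ)) (hE k hk)
      refine Set.inter_subset_inter_right _ ?_
      have := Set.iInter_subset (fun k => tower (I (k + k1)) (F (k + k1))) (k - k1)
      rwa [Nat.sub_add_cancel hk] at this
    -- The scales need not be monotone; the least such `k` still satisfies `δ < ν (I k)`. If there
    -- is none, the bound at every scale forces measure `0`.
    by_cases hex : ∃ k, k1 ≤ k ∧ ν (I (k + 1)) ≤ δ
    · classical
      obtain ⟨h1, h2⟩ := Nat.find_spec hex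
      set k := Nat.find hex with hkdef
      have h3 : δ < ν (I k) := by
        rcases h1.eq_or_lt with h | h
        · rw [← h]; exact hUd
        · have := Nat.find_min hex (m := k - 1) (by omega)
          push Not at this
          have := this (by omega)
          rwa [Nat.sub_add_cancel (by omega)] at this
      exact (hstep k h1 h3).trans (ENNReal.rpow_le_rpow h2 hz.le)
    · push Not at hex
      have hall : ∀ k ≥ k1, δ < ν (I k) := by
        intro k hk
        rcases hk.eq_or_lt with h | h
        · rw [← h]; exact hUd
        · have := hex (k - 1) (by omega)
          rwa [Nat.sub_add_cancel (by omega)] at this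
      have : μ (U ∩ E) ≤ 0 := by
        refine ge_of_tendsto hνlim ?_
        filter_upwards [eventually_ge_atTop k1] with k hk
        exact hstep k hk (hall k hk)
      exact this.trans bot_le
  have hpre : μ E ≤ hausdorffPre (Set.Ico (0 : ℝ) 1) (measureDist ν) z (ν (I k1)) A := by
    refine le_iInf fun U => le_iInf fun _ => le_iInf fun hcov => le_iInf fun hd => ?_
    calc μ E ≤ μ (Aᶜ ∪ ⋃ m, (U m ∩ E)) := by
          refine measure_mono fun x hx => ?_
          by_cases hxA : x ∈ A
          · right
            obtain ⟨m, hm⟩ := Set.mem_iUnion.1 (hcov hxA)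
            exact Set.mem_iUnion.2 ⟨m, hm, hx⟩
          · exact Or.inl hxA
      _ ≤ μ Aᶜ + μ (⋃ m, (U m ∩ E)) := measure_union_le _ _
      _ ≤ ∑' m, μ (U m ∩ E) := by rw [hA1, zero_add]; exact measure_iUnion_le _
      _ ≤ ∑' m, diamOf (measureDist ν) (U m) ^ z := ENNReal.tsum_le_tsum fun m => hU _ (hd m)
  have hle : hausdorffPre (Set.Ico (0 : ℝ) 1) (measureDist ν) z (ν (I k1)) A
      ≤ hausdorffMeas (Set.Ico (0 : ℝ) 1) (measureDist ν) z A := by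
    refine le_iSup₂_of_le (f := fun ε _ => hausdorffPre (Set.Ico (0 : ℝ) 1) (measureDist ν) z ε A)
      (ν (I k1)) ?_ le_rfl
    have := hpos k1
    rw [measureReal_def] at this
    exact (ENNReal.toReal_pos_iff.1 this).1
  rw [hH] at hle
  exact absurd hEpos (not_lt.2 (hpre.trans hle))

/-- For `z` above the `liminf`, infinitely many `k` make `(F k).length * ν (I k) ^ z` arbitrarily
small. This is the cost of covering a tower by its floors, and along a sparse subsequence the costs
are summable. -/
theorem measureDim_le_of_towers [IsFiniteMeasure ν]
    (hT : ∀ k, IsTower (I k) (F k)) (hne : ∀ k, F k ≠ [])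
    (hν : ∀ k, FloorInvariant (I k) (F k) ν)
    (htower : Tendsto (fun k => μ (tower (I k) (F k))ᶜ) atTop (𝓝 0))
    (hpos : ∀ k, 0 < ν.real (I k))
    (hlim : Tendsto (fun k => ν.real (I k)) atTop (𝓝 0)) :
    measureDim (Set.Ico (0 : ℝ) 1) (measureDist ν) μ ≤
      liminf (fun k : ℕ => ((Real.logb (ν.real (I k)) (((F k).length : ℝ)⁻¹) : ℝ) : EReal))
        atTop := by
  refine EReal.le_of_forall_lt_iff_le.1 fun z hz => ?_
  obtain ⟨z', hz1, hz2⟩ := EReal.lt_iff_exists_real_btwn.1 hz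
  have hzz : z' < z := EReal.coe_lt_coe_iff.1 hz2
  have hfreq := frequently_lt_of_liminf_lt (by isBoundedDefault) hz1
  have hev1 := hlim.eventually (gt_mem_nhds one_pos)
  have hb : ∀ k, (1 : ℝ) ≤ (F k).length := fun k => by
    exact_mod_cast List.length_pos_iff.2 (hne k)
  -- Only positive exponents compete in `hausdorffDim`. The logarithm to a base below `1` of the
  -- inverse of a nonempty tower's height is nonnegative.
  have hz0 : 0 < z' := by
    obtain ⟨k, h1, h2⟩ := (hfreq.and_eventually hev1).exists
    refine lt_of_le_of_lt ?_ (EReal.coe_lt_coe_iff.1 h1)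
    rw [Real.logb, Real.log_inv]
    refine div_nonneg_of_nonpos ?_ (Real.log_neg (hpos k) h2).le
    exact neg_nonpos.2 (Real.log_nonneg (hb k))
  have hsmall : Tendsto (fun k => ν.real (I k) ^ (z - z')) atTop (𝓝 0) := by
    have := hlim.rpow_const (p := z - z') (Or.inr (by linarith))
    rwa [Real.zero_rpow (by linarith)] at this
  have hνE : ∀ k, ENNReal.ofReal (ν.real (I k)) = ν (I k) := fun k => by simp
  have hex : ∀ m : ℕ, ∃ k, ((F k).length : ℝ≥0∞) * ν (I k) ^ z ≤ 2⁻¹ ^ m ∧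
      μ (tower (I k) (F k))ᶜ ≤ 2⁻¹ ^ m ∧ ν (I k) ≤ 2⁻¹ ^ m := by
    intro m
    have hp : (0 : ℝ≥0∞) < 2⁻¹ ^ m := ENNReal.pow_pos (by simp) m
    have hpR : (0 : ℝ) < 2⁻¹ ^ m := by positivity
    have hpe : ENNReal.ofReal (2⁻¹ ^ m) = 2⁻¹ ^ m := by
      rw [ENNReal.ofReal_pow (by norm_num), ENNReal.ofReal_inv_of_pos (by norm_num),
        ENNReal.ofReal_ofNat]
    obtain ⟨k, h1, h2, h3, h4, h5⟩ := (hfreq.and_eventually (hev1.and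
      ((htower.eventually (gt_mem_nhds hp)).and ((hlim.eventually (gt_mem_nhds hpR)).and
        (hsmall.eventually (gt_mem_nhds hpR)))))).exists
    refine ⟨k, ?_, h3.le, ?_⟩
    · have hlen : (0 : ℝ) < (F k).length := lt_of_lt_of_le one_pos (hb k)
      have h6 : ν.real (I k) ^ z' < ((F k).length : ℝ)⁻¹ :=
        (Real.logb_lt_iff_lt_rpow_of_base_lt_one (hpos k) h2 (inv_pos.2 hlen)).1
          (EReal.coe_lt_coe_iff.1 h1)
      have h7 : ((F k).length : ℝ) * ν.real (I k) ^ z ≤ 2⁻¹ ^ m := by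
        have h8 : ν.real (I k) ^ z = ν.real (I k) ^ z' * ν.real (I k) ^ (z - z') := by
          rw [← Real.rpow_add (hpos k)]; congr 1; ring
        have h9 : ((F k).length : ℝ) * ν.real (I k) ^ z' ≤ 1 := by
          have := mul_le_mul_of_nonneg_left h6.le hlen.le
          rwa [mul_inv_cancel₀ hlen.ne'] at this
        calc ((F k).length : ℝ) * ν.real (I k) ^ z
            = ((F k).length * ν.real (I k) ^ z') * ν.real (I k) ^ (z - z') := by rw [h8]; ring
          _ ≤ 1 * ν.real (I k) ^ (z - z') := by
            gcongr
          _ ≤ 2⁻¹ ^ m := by rw [one_mul]; exact h5.le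
      have := ENNReal.ofReal_le_ofReal h7
      rwa [hpe, ENNReal.ofReal_mul hlen.le, ← ENNReal.ofReal_rpow_of_pos (hpos k), hνE,
        ENNReal.ofReal_natCast] at this
    · have := ENNReal.ofReal_le_ofReal h4.le
      rwa [hpe, hνE] at this
  choose κ hκ1 hκ2 hκ3 using hex
  have hhalf : Tendsto (fun m : ℕ => (2⁻¹ : ℝ≥0∞) ^ m) atTop (𝓝 0) :=
    ENNReal.tendsto_pow_atTop_nhds_zero_of_lt_one (by simp)
  -- The upper limit of the chosen towers: of full measure since their complements have measure
  -- tending to `0`, and covered by the floors of any tail.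
  set A : Set ℝ := ⋂ N : ℕ, ⋃ m : ℕ, tower (I (κ (N + m))) (F (κ (N + m))) with hA
  have hAX : A ⊆ Set.Ico (0 : ℝ) 1 := by
    intro x hx
    obtain ⟨m, hm⟩ := Set.mem_iUnion.1 (Set.mem_iInter.1 hx 0)
    exact (hT _).subset hm
  have hAm : MeasurableSet A := MeasurableSet.iInter fun N => MeasurableSet.iUnion fun m =>
    measurableSet_tower (hT _).measurableSet
  have hA0 : μ (Set.Ico (0 : ℝ) 1 \ A) = 0 := by
    refine measure_mono_null (t := Aᶜ) (fun x hx => hx.2) ?_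
    rw [hA, Set.compl_iInter, measure_iUnion_null_iff]
    intro N
    rw [Set.compl_iUnion]
    refine le_antisymm ?_ bot_le
    refine ge_of_tendsto (hhalf.comp (tendsto_add_atTop_nat N)) (Eventually.of_forall fun m => ?_)
    refine (measure_mono (Set.iInter_subset _ m)).trans ?_
    simpa [add_comm] using hκ2 (N + m)
  refine iInf_le_of_le A (iInf_le_of_le hAX (iInf_le_of_le hAm (iInf_le_of_le hA0 ?_)))
  refine iInf_le_of_le z (iInf_le_of_le (hz0.trans hzz) (iInf_le_of_le ?_ le_rfl))
  refine le_antisymm (iSup₂_le fun ε hε => ?_) bot_le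
  have hz00 : 0 < z := hz0.trans hzz
  have htail : Tendsto (fun N : ℕ => ∑' m : ℕ, (2⁻¹ : ℝ≥0∞) ^ (N + m)) atTop (𝓝 0) := by
    simp only [pow_add, ENNReal.tsum_mul_left]
    have := ENNReal.Tendsto.mul_const (b := ∑' m : ℕ, (2⁻¹ : ℝ≥0∞) ^ m) hhalf (Or.inr (by
      rw [ENNReal.tsum_geometric]; simp))
    rwa [zero_mul] at this
  refine ge_of_tendsto htail ?_
  filter_upwards [hhalf.eventually (gt_mem_nhds hε)] with N hN
  -- One sequence enumerates all floors: `q` codes a tower and a position in its list. Positions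
  -- beyond the list give the empty set, which costs nothing as `z > 0`.
  set U : ℕ → Set ℝ := fun q => {x | ∃ s, (F (κ (N + q.unpair.1)))[q.unpair.2]? = some s ∧
    x - s ∈ I (κ (N + q.unpair.1))} with hUdef
  have hUempty : ∀ q, (F (κ (N + q.unpair.1))).length ≤ q.unpair.2 → U q = ∅ := by
    intro q hq
    ext x
    simp [hUdef, List.getElem?_eq_none hq]
  have hUd : ∀ q, diamOf (measureDist ν) (U q) ≤
      if q.unpair.2 < (F (κ (N + q.unpair.1))).length then ν (I (κ (N + q.unpair.1))) else 0 := by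
    intro q
    split_ifs with hq
    · refine iSup₂_le fun x hx => iSup₂_le fun y hy => ?_
      obtain ⟨s, hs, hx⟩ := hx
      obtain ⟨s', hs', hy⟩ := hy
      rw [hs] at hs'
      obtain rfl := Option.some.inj hs'
      rw [← hν _ s (List.mem_of_getElem? hs)]
      refine measure_mono fun u hu => ?_
      obtain ⟨lo, hi, -, hI⟩ := (hT (κ (N + q.unpair.1))).exists_Ico
      rw [hI, Set.mem_Ico] at hx hy
      rw [hI, Set.mem_preimage, Set.mem_Ico]
      rcases Set.mem_uIcc.1 hu with ⟨h1, h2⟩ | ⟨h1, h2⟩ <;> constructor <;> linarith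
    · rw [hUempty q (not_lt.1 hq)]
      simp [diamOf]
  refine iInf_le_of_le U (iInf_le_of_le ?_ (iInf_le_of_le ?_ (iInf_le_of_le ?_ ?_)))
  · rintro q x ⟨s, hs, hx⟩
    exact (hT _).subset ⟨s, List.mem_of_getElem? hs, hx⟩
  · intro x hx
    obtain ⟨m, s, hs, hxs⟩ := Set.mem_iUnion.1 (Set.mem_iInter.1 hx N)
    obtain ⟨t, ht⟩ := List.mem_iff_getElem?.1 hs
    refine Set.mem_iUnion.2 ⟨Nat.pair m t, s, ?_⟩
    simpa using ⟨ht, hxs⟩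
  · intro q
    refine (hUd q).trans_lt ?_
    split_ifs
    · refine (hκ3 _).trans_lt (lt_of_le_of_lt ?_ hN)
      exact pow_le_pow_of_le_one bot_le (by simp) (Nat.le_add_right _ _)
    · exact hε
  · set f : ℕ → ℕ → ℝ≥0∞ := fun m t =>
      (if t < (F (κ (N + m))).length then ν (I (κ (N + m))) else 0) ^ z with hf
    calc ∑' q, diamOf (measureDist ν) (U q) ^ z
        ≤ ∑' q : ℕ, f q.unpair.1 q.unpair.2 :=
          ENNReal.tsum_le_tsum fun q => ENNReal.rpow_le_rpow (hUd q) hz00.le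
      _ = ∑' m, ∑' t, f m t := by
          rw [← ENNReal.tsum_prod (f := f)]
          exact Nat.pairEquiv.symm.tsum_eq (fun x : ℕ × ℕ => f x.1 x.2)
      _ ≤ ∑' m : ℕ, (2⁻¹ : ℝ≥0∞) ^ (N + m) := by
          refine ENNReal.tsum_le_tsum fun m => ?_
          refine le_trans (le_of_eq ?_) (hκ1 (N + m))
          rw [tsum_eq_sum (s := Finset.range (F (κ (N + m))).length)]
          · rw [Finset.sum_congr rfl (g := fun _ => ν (I (κ (N + m))) ^ z)]
            · simp
            · intro t ht
              simp only [hf]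
              rw [if_pos (Finset.mem_range.1 ht)]
          · intro t ht
            simp only [hf]
            rw [if_neg (by simpa using ht), ENNReal.zero_rpow_of_pos hz00]

end Dimension

/-! ### Growth of the return times -/

section Parameters

/-- The parameters of the closed paths grow geometrically. -/
structure GeometricParameters (n p : ℕ) (a c : ℕ → ℕ) : Prop where
  four_le : 4 ≤ n
  lt_p : n + 1 ≤ p
  a_eq : ∀ m, a (m + 1) = p * c (m + 1)
  c_eq : ∀ m, c (m + 1) = p ^ (2 * m) * c 1
  c_pos : 0 < c 1

variable {n p : ℕ} {a c : ℕ → ℕ}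

theorem GeometricParameters.pow_le (hp : GeometricParameters n p a c) (k : ℕ) :
    p ^ (2 * k) ≤ c (k + 1) := by
  rw [hp.c_eq]
  exact Nat.le_mul_of_pos_right _ hp.c_pos

/-- The constants come from `p ≥ n + 1 ≥ 5`, whence `p ^ (2 * k) ≥ 25 ^ k`. -/
theorem GeometricParameters.c_le (hp : GeometricParameters n p a c) (k : ℕ) :
    (5 * c (k + 1) : ℝ) ≤ a (k + 1) ∧ ((n : ℝ) + 1) * 25 ^ k ≤ a (k + 1) ∧
      (1 : ℝ) ≤ c (k + 1) ∧ (n : ℝ) + 1 ≤ a (k + 1) := by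
  have hpn : (n : ℝ) + 1 ≤ p := by exact_mod_cast hp.lt_p
  have hp5 : (5 : ℝ) ≤ p := by exact_mod_cast (by have := hp.lt_p; have := hp.four_le; omega)
  have hc : (p : ℝ) ^ (2 * k) ≤ c (k + 1) := by exact_mod_cast hp.pow_le k
  have h25 : (25 : ℝ) ^ k ≤ p ^ (2 * k) := by
    rw [pow_mul]; gcongr; nlinarith
  have h1 : (1 : ℝ) ≤ 25 ^ k := one_le_pow₀ (by norm_num)
  have ha : (a (k + 1) : ℝ) = p * c (k + 1) := by rw [hp.a_eq]; push_cast; ring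
  have hn0 : (0 : ℝ) ≤ n := Nat.cast_nonneg n
  have h2 : ((n : ℝ) + 1) * 25 ^ k ≤ a (k + 1) := by
    rw [ha]
    exact mul_le_mul hpn (h25.trans hc) (by positivity) (by positivity)
  refine ⟨by rw [ha]; gcongr, h2, h1.trans (h25.trans hc), le_trans ?_ h2⟩
  nlinarith

theorem GeometricParameters.a_pos (hp : GeometricParameters n p a c) (k : ℕ) : 0 < a (k + 1) := by
  have := (hp.c_le k).2.2.2
  have hn : (0 : ℝ) ≤ n := Nat.cast_nonneg n
  exact_mod_cast (by linarith : (0 : ℝ) < a (k + 1))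

theorem GeometricParameters.c_pos' (hp : GeometricParameters n p a c) (k : ℕ) :
    0 < c (k + 1) := by
  have := (hp.c_le k).2.2.1
  exact_mod_cast (by linarith : (0 : ℝ) < c (k + 1))

theorem GeometricParameters.a_formula (hp : GeometricParameters n p a c) (k : ℕ) :
    (a (k + 1) : ℝ) = p ^ (2 * k + 1) * c 1 := by
  rw [hp.a_eq, hp.c_eq]
  push_cast
  ring

end Parameters

/-! ### The recursion for the return times, and the dominance of the diagonal. -/

section Growth

variable {n : ℕ} [NeZero n]

theorem vecMul_theta (hn : 4 ≤ n) (a c : ℕ) (h : Fin n → ℕ) :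
    Matrix.vecMul h (Theta n a c) 0 = h 0 + h (lastLabel n)
      ∧ Matrix.vecMul h (Theta n a c) (lastLabel n)
        = c * (h 0 + h (lastLabel n)) + h (lastLabel n) + oddSum h
      ∧ (∀ r < n / 2 - 1, Matrix.vecMul h (Theta n a c) (pairFst n r)
          = Matrix.vecMul h (Theta n a c) (lastLabel n) + h (pairFst n r) + a * h (pairSnd n r))
      ∧ (∀ r < n / 2 - 1, Matrix.vecMul h (Theta n a c) (pairSnd n r)
          = Matrix.vecMul h (Theta n a c) (lastLabel n) + h (pairFst n r)
            + (a + 1) * h (pairSnd n r))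
      ∧ (n % 2 = 1 → Matrix.vecMul h (Theta n a c) (penLabel n)
          = Matrix.vecMul h (Theta n a c) (lastLabel n) + h (penLabel n)) := by
  obtain ⟨h', h1, h2⟩ := track_cycle hn a c h
  have : Matrix.vecMul h (Theta n a c) = h' := by
    rw [Theta, vecMul_pathMatrix, h1]
  rw [this]
  exact h2

theorem label_cases (hn : 4 ≤ n) (t : Fin n) : t = 0 ∨ t = lastLabel n
    ∨ (∃ r < n / 2 - 1, t = pairFst n r) ∨ (∃ r < n / 2 - 1, t = pairSnd n r)
    ∨ (n % 2 = 1 ∧ t = penLabel n) := by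
  have ht := t.2
  by_cases h0 : t.val = 0
  · exact Or.inl (Fin.ext h0)
  by_cases h1 : t.val = n - 1
  · exact Or.inr (Or.inl (Fin.ext (by rw [val_lastLabel, h1])))
  by_cases h2 : t.val % 2 = 0
  · exact Or.inr (Or.inr (Or.inr (Or.inl ⟨t.val / 2 - 1, by omega,
      Fin.ext (by rw [val_pairSnd (by omega)]; omega)⟩)))
  by_cases h3 : t.val = n - 2
  · exact Or.inr (Or.inr (Or.inr (Or.inr ⟨by omega, Fin.ext (by rw [val_penLabel, h3])⟩)))
  · exact Or.inr (Or.inr (Or.inl ⟨t.val / 2, by omega,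
      Fin.ext (by rw [val_pairFst (by omega)]; omega)⟩))

theorem IsIndex.cases (hn : 4 ≤ n) {i : Fin n} (hi : IsIndex i) :
    i = lastLabel n ∨ ∃ r < n / 2 - 1, i = pairSnd n r := by
  rcases hi with ⟨h1, h2, h3⟩ | h
  · exact Or.inr ⟨i.val / 2 - 1, by omega, Fin.ext (by rw [val_pairSnd (by omega)]; omega)⟩
  · exact Or.inl (Fin.ext (by rw [val_lastLabel]; omega))

theorem oddSum_le (hn : 4 ≤ n) {h : Fin n → ℕ} {H : ℝ} (hH : ∀ t, (h t : ℝ) ≤ H) :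
    (oddSum h : ℝ) ≤ n * H := by
  have hH0 : 0 ≤ H := le_trans (Nat.cast_nonneg _) (hH 0)
  have h1 : (∑ r ∈ Finset.range (n / 2 - 1), (h (pairFst n r) : ℝ))
      ≤ ((n / 2 - 1 : ℕ) : ℝ) * H := by
    refine (Finset.sum_le_card_nsmul _ _ H fun r _ => hH _).trans ?_
    simp
  have h2 : ((if n % 2 = 1 then h (penLabel n) else 0 : ℕ) : ℝ) ≤ H := by
    split_ifs
    · exact hH _
    · simpa using hH0
  have h3 : (((n / 2 - 1 : ℕ) : ℝ) + 1) ≤ n := by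
    exact_mod_cast (show n / 2 - 1 + 1 ≤ n by omega)
  rw [oddSum, Nat.cast_add, Nat.cast_sum]
  calc _ ≤ ((n / 2 - 1 : ℕ) : ℝ) * H + H := add_le_add h1 h2
    _ = (((n / 2 - 1 : ℕ) : ℝ) + 1) * H := by ring
    _ ≤ n * H := by gcongr

theorem vecMul_theta_le (hn : 4 ≤ n) (a c : ℕ) {h : Fin n → ℕ} {H : ℝ}
    (hH : ∀ t, (h t : ℝ) ≤ H) (t : Fin n) :
    ((Matrix.vecMul h (Theta n a c) t : ℕ) : ℝ)
      ≤ (Matrix.vecMul h (Theta n a c) (lastLabel n) : ℕ) + (a + 2) * H := by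
  have hH0 : 0 ≤ H := le_trans (Nat.cast_nonneg _) (hH 0)
  obtain ⟨h0, -, hx, hy, hq⟩ := vecMul_theta hn a c h
  have ha : (0 : ℝ) ≤ a := Nat.cast_nonneg a
  set W : ℕ := Matrix.vecMul h (Theta n a c) (lastLabel n)
  have hW : (0 : ℝ) ≤ W := Nat.cast_nonneg W
  rcases label_cases hn t with rfl | rfl | ⟨r, hr, rfl⟩ | ⟨r, hr, rfl⟩ | ⟨ho, rfl⟩
  · rw [h0]
    push_cast
    nlinarith [hH 0, hH (lastLabel n), mul_nonneg ha hH0]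
  · nlinarith [mul_nonneg ha hH0]
  · rw [hx r hr]
    push_cast
    nlinarith [hH (pairFst n r), mul_le_mul_of_nonneg_left (hH (pairSnd n r)) ha]
  · rw [hy r hr]
    push_cast
    nlinarith [hH (pairFst n r), hH (pairSnd n r), mul_le_mul_of_nonneg_left (hH (pairSnd n r)) ha]
  · rw [hq ho]
    push_cast
    nlinarith [hH (penLabel n), mul_nonneg ha hH0]

variable {p : ℕ} {a c : ℕ → ℕ}

theorem returnTime_zero (t : Fin n) : returnTime a c 0 t = 1 := by
  simp [returnTime, thetaProd, Matrix.one_apply]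

theorem returnTime_eq (k : ℕ) :
    returnTime (n := n) a c k = Matrix.vecMul (fun _ => 1) (thetaProd n a c k) := by
  funext t
  simp [returnTime, Matrix.vecMul, dotProduct]

theorem returnTime_succ (k : ℕ) : returnTime (n := n) a c (k + 1)
    = Matrix.vecMul (returnTime a c k) (Theta n (a (k + 1)) (c (k + 1))) := by
  rw [returnTime_eq, returnTime_eq, Matrix.vecMul_vecMul]
  rfl

theorem theta_diag_eq (a c : ℕ) (i : Fin n) :
    Theta n a c i i = Matrix.vecMul (Pi.single i 1) (Theta n a c) i := by
  rw [Matrix.single_one_vecMul]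
  rfl

theorem le_theta_last (hn : 4 ≤ n) (a c : ℕ) :
    c + 1 ≤ Theta n a c (lastLabel n) (lastLabel n) := by
  rw [theta_diag_eq, (vecMul_theta hn a c _).2.1, Pi.single_eq_same]
  nlinarith [Nat.zero_le (oddSum (Pi.single (lastLabel n) 1)),
    Nat.zero_le (c * (Pi.single (lastLabel n) 1 : Fin n → ℕ) 0)]

theorem le_theta_pairSnd (hn : 4 ≤ n) (a c : ℕ) {r : ℕ} (hr : r < n / 2 - 1) :
    a + 1 ≤ Theta n a c (pairSnd n r) (pairSnd n r) := by
  rw [theta_diag_eq, (vecMul_theta hn a c _).2.2.2.1 r hr, Pi.single_eq_same]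
  omega

theorem vecMul_last_le (hn : 4 ≤ n) (a c : ℕ) {h : Fin n → ℕ} {H : ℝ}
    (hH : ∀ t, (h t : ℝ) ≤ H) :
    ((Matrix.vecMul h (Theta n a c) (lastLabel n) : ℕ) : ℝ)
      ≤ c * (h 0 + h (lastLabel n)) + h (lastLabel n) + n * H := by
  rw [(vecMul_theta hn a c h).2.1]
  push_cast
  linarith [oddSum_le hn hH]

/-- In one stage the last return time grows at least by `c + 1`, the others at most by about `a = p
c`, so their quotient gains at most a factor of order `p`. The `- 1` lets the induction close: the
new last return time, added once more, is paid for by `p ≥ 2`. -/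
theorem returnTime_le_last (hp : GeometricParameters n p a c) (k : ℕ) (t : Fin n) :
    (returnTime a c k t : ℝ) ≤ (2 * p ^ k - 1) * returnTime a c k (lastLabel n) := by
  have hp2 : (2 : ℝ) ≤ p := by exact_mod_cast (by have := hp.lt_p; have := hp.four_le; omega)
  induction k generalizing t with
  | zero => simp only [returnTime_zero]; norm_num
  | succ k ih =>
    have h1 := vecMul_theta_le hp.four_le (a (k + 1)) (c (k + 1)) ih t
    rw [← returnTime_succ] at h1
    refine h1.trans ?_
    have h2 : ((c (k + 1) : ℝ) + 1) * returnTime a c k (lastLabel n)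
        ≤ returnTime a c (k + 1) (lastLabel n) := by
      rw [returnTime_succ, (vecMul_theta hp.four_le _ _ _).2.1]
      push_cast
      nlinarith [Nat.cast_nonneg (α := ℝ) (oddSum (returnTime (n := n) a c k)),
        mul_nonneg (Nat.cast_nonneg (α := ℝ) (c (k + 1)))
          (Nat.cast_nonneg (α := ℝ) (returnTime (n := n) a c k 0))]
    have ha : (a (k + 1) : ℝ) + 2 ≤ p * (c (k + 1) + 1) := by
      rw [hp.a_eq]; push_cast; nlinarith
    have hpk : (1 : ℝ) ≤ p ^ k := one_le_pow₀ (by linarith)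
    set x : ℝ := ((returnTime a c k (lastLabel n) : ℕ) : ℝ)
    set y : ℝ := ((returnTime a c (k + 1) (lastLabel n) : ℕ) : ℝ)
    have hx : 0 ≤ x := Nat.cast_nonneg _
    have hy : 0 ≤ y := Nat.cast_nonneg _
    calc y + (a (k + 1) + 2) * ((2 * p ^ k - 1) * x)
        ≤ y + (p * (c (k + 1) + 1)) * ((2 * p ^ k - 1) * x) := by
          gcongr
          exact mul_nonneg (by linarith) hx
      _ = y + p * (2 * p ^ k - 1) * ((c (k + 1) + 1) * x) := by ring
      _ ≤ y + p * (2 * p ^ k - 1) * y := by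
          gcongr
          exact mul_nonneg (by linarith) (by linarith)
      _ = (2 * p ^ (k + 1) - 1) * y - (p - 2) * y := by ring
      _ ≤ (2 * p ^ (k + 1) - 1) * y := by
          have := mul_nonneg (sub_nonneg.2 hp2) hy
          linarith

theorem returnTime_first_le_last (hp : GeometricParameters n p a c) (k : ℕ) :
    (returnTime (n := n) a c k 0 : ℝ) ≤ returnTime a c k (lastLabel n) := by
  cases k with
  | zero => simp only [returnTime_zero]; norm_num
  | succ k =>
    have hc : 1 ≤ c (k + 1) := le_trans (Nat.one_le_pow _ _ (by have := hp.lt_p; omega))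
      (hp.pow_le k)
    rw [returnTime_succ, (vecMul_theta hp.four_le _ _ _).2.1, (vecMul_theta hp.four_le _ _ _).1]
    exact_mod_cast (by nlinarith : _ ≤ _)

/-- The first return time is just a sum of two earlier ones, while the last is multiplied by `c (k +
1) ≥ p ^ (2 * k)`. A factor `p ^ k` is all that is needed. -/
theorem returnTime_first_le (hp : GeometricParameters n p a c) (k : ℕ) :
    (p : ℝ) ^ k * returnTime (n := n) a c k 0 ≤ 2 * p * returnTime a c k (lastLabel n) := by
  have hp2 : (2 : ℝ) ≤ p := by exact_mod_cast (by have := hp.lt_p; have := hp.four_le; omega)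
  cases k with
  | zero => simp only [returnTime_zero]; push_cast; linarith
  | succ k =>
    have hc : (p : ℝ) ^ (2 * k) ≤ c (k + 1) := by exact_mod_cast hp.pow_le k
    have hpk : (1 : ℝ) ≤ p ^ k := one_le_pow₀ (by linarith)
    rw [returnTime_succ, (vecMul_theta hp.four_le _ _ _).2.1, (vecMul_theta hp.four_le _ _ _).1]
    have h0 := returnTime_first_le_last hp k
    set x : ℝ := ((returnTime a c k (lastLabel n) : ℕ) : ℝ)
    have hx : 0 ≤ x := Nat.cast_nonneg _
    have h1 : (0 : ℝ) ≤ returnTime (n := n) a c k 0 := Nat.cast_nonneg _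
    have h2 : (0 : ℝ) ≤ oddSum (returnTime (n := n) a c k) := Nat.cast_nonneg _
    push_cast
    have hc2 : (p : ℝ) ^ k ≤ c (k + 1) := by
      refine le_trans ?_ hc
      exact pow_le_pow_right₀ (by linarith) (by omega)
    have hc0 : (0 : ℝ) ≤ c (k + 1) := Nat.cast_nonneg _
    calc (p : ℝ) ^ (k + 1) * (returnTime a c k 0 + x) ≤ p ^ (k + 1) * (x + x) := by gcongr
      _ = 2 * p * (p ^ k * x) := by ring
      _ ≤ 2 * p * (c (k + 1) * x) := by gcongr
      _ ≤ _ := by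
        gcongr
        nlinarith [mul_nonneg hc0 h1]

/-- There are two sources of excess: `c` times the first return time, which is smaller than the last
by `p ^ k`, and the odd labels, which exceed the last by at most about `2 * p ^ k`, against a factor
`c (k + 1) ≥ p ^ (2 * k)`. Each has a share of order `p ^ (-k)`. -/
theorem excess_last (hp : GeometricParameters n p a c) (k : ℕ) :
    (returnTime a c (k + 1) (lastLabel n) : ℝ) - returnTime a c k (lastLabel n)
        * Theta n (a (k + 1)) (c (k + 1)) (lastLabel n) (lastLabel n)
      ≤ 4 * p * (1 / p : ℝ) ^ k * returnTime a c (k + 1) (lastLabel n) := by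
  have hpn : (n : ℝ) ≤ p := by exact_mod_cast (by have := hp.lt_p; omega)
  have hp2 : (2 : ℝ) ≤ p := by exact_mod_cast (by have := hp.lt_p; have := hp.four_le; omega)
  have hn := hp.four_le
  have h1 := returnTime_le_last hp k
  have h2 := returnTime_first_le hp k
  have h3 : ((c (k + 1) : ℝ) + 1)
      ≤ Theta n (a (k + 1)) (c (k + 1)) (lastLabel n) (lastLabel n) := by
    exact_mod_cast le_theta_last hn _ _
  have h4 := vecMul_last_le hn (a (k + 1)) (c (k + 1)) h1
  have h5 := (vecMul_theta hn (a (k + 1)) (c (k + 1)) (returnTime a c k)).2.1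
  rw [← returnTime_succ] at h4 h5
  set x : ℝ := ((returnTime a c k (lastLabel n) : ℕ) : ℝ)
  set y : ℝ := ((returnTime a c (k + 1) (lastLabel n) : ℕ) : ℝ) with hy
  set u : ℝ := ((returnTime (n := n) a c k 0 : ℕ) : ℝ)
  have hx : 0 ≤ x := Nat.cast_nonneg _
  have hu : 0 ≤ u := Nat.cast_nonneg _
  have hc0 : (0 : ℝ) ≤ c (k + 1) := Nat.cast_nonneg _
  have hyx : (c (k + 1) : ℝ) * x ≤ y := by
    rw [hy, h5]
    push_cast
    have : (0 : ℝ) ≤ oddSum (returnTime (n := n) a c k) := Nat.cast_nonneg _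
    nlinarith [mul_nonneg hc0 hu]
  have hpk : (0 : ℝ) < p ^ k := by positivity
  have hc : (p : ℝ) ^ k * p ^ k ≤ c (k + 1) := by
    rw [← pow_add, ← two_mul]; exact_mod_cast hp.pow_le k
  have hn0 : (0 : ℝ) ≤ n := Nat.cast_nonneg _
  have e1 : y - x * Theta n (a (k + 1)) (c (k + 1)) (lastLabel n) (lastLabel n)
      ≤ c (k + 1) * u + n * (2 * p ^ k) * x := by
    nlinarith [mul_le_mul_of_nonneg_left h3 hx, mul_nonneg hn0 hx]
  refine e1.trans ?_
  rw [one_div, inv_pow, ← div_eq_mul_inv, div_mul_eq_mul_div, le_div_iff₀ hpk]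
  have e2 : c (k + 1) * u * (p : ℝ) ^ k ≤ 2 * p * y := by
    calc c (k + 1) * u * (p : ℝ) ^ k = c (k + 1) * (p ^ k * u) := by ring
      _ ≤ c (k + 1) * (2 * p * x) := by gcongr
      _ = 2 * p * (c (k + 1) * x) := by ring
      _ ≤ 2 * p * y := by gcongr
  have e3 : n * (2 * p ^ k) * x * (p : ℝ) ^ k ≤ 2 * p * y := by
    calc n * (2 * p ^ k) * x * (p : ℝ) ^ k = 2 * n * ((p ^ k * p ^ k) * x) := by ring
      _ ≤ 2 * p * (c (k + 1) * x) := by gcongr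
      _ ≤ 2 * p * y := by gcongr
  linarith [e2, e3]

/-! ### Return times relative to the second label of a pair. -/

section PairSnd

variable {r : ℕ}

theorem le_returnTime_pairSnd (hn : 4 ≤ n) (hr : r < n / 2 - 1) (k : ℕ) :
    returnTime a c (k + 1) (lastLabel n) + returnTime a c k (pairFst n r)
        + (a (k + 1) + 1) * returnTime a c k (pairSnd n r)
      = returnTime a c (k + 1) (pairSnd n r) := by
  rw [returnTime_succ, (vecMul_theta hn _ _ _).2.2.2.1 r hr]

/-- A crude comparison: `pairSnd` gains at least `a + 1` per stage and no label more than about `3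
(a + 1)` times the current bound. The resulting `3 ^ k` is harmless next to `a (k + 1) ≥ (n + 1) *
25 ^ k`. -/
theorem returnTime_le_pairSnd (hp : GeometricParameters n p a c) (hr : r < n / 2 - 1) (k : ℕ)
    (t : Fin n) : (returnTime a c k t : ℝ) ≤ 3 ^ k * returnTime a c k (pairSnd n r) := by
  have hn := hp.four_le
  induction k generalizing t with
  | zero => simp only [returnTime_zero]; norm_num
  | succ k ih =>
    obtain ⟨hc1, -, hc3, hc4⟩ := hp.c_le k
    have h1 := vecMul_theta_le hn (a (k + 1)) (c (k + 1)) ih t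
    have h2 := vecMul_last_le hn (a (k + 1)) (c (k + 1)) ih
    have h3 := le_returnTime_pairSnd (a := a) (c := c) hn hr k
    have h3' : ((a (k + 1) : ℝ) + 1) * returnTime a c k (pairSnd n r)
        ≤ returnTime a c (k + 1) (pairSnd n r) := by
      exact_mod_cast (by omega : (a (k + 1) + 1) * returnTime a c k (pairSnd n r)
        ≤ returnTime a c (k + 1) (pairSnd n r))
    have h0 := ih 0
    have hz := ih (lastLabel n)
    rw [← returnTime_succ] at h1 h2
    set x : ℝ := ((returnTime a c k (pairSnd n r) : ℕ) : ℝ)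
    have hH : (0 : ℝ) ≤ 3 ^ k * x := by positivity
    have hc0 : (0 : ℝ) ≤ c (k + 1) := Nat.cast_nonneg _
    calc (returnTime a c (k + 1) t : ℝ)
        ≤ (2 * c (k + 1) + 1 + n + (a (k + 1) + 2)) * (3 ^ k * x) := by
          nlinarith [mul_le_mul_of_nonneg_left h0 hc0, mul_le_mul_of_nonneg_left hz hc0]
      _ ≤ (3 * (a (k + 1) + 1)) * (3 ^ k * x) := by
          gcongr
          linarith
      _ = 3 ^ (k + 1) * ((a (k + 1) + 1) * x) := by ring
      _ ≤ _ := by gcongr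

theorem returnTime_last_succ_le (hp : GeometricParameters n p a c) (hr : r < n / 2 - 1) (k : ℕ) :
    (returnTime a c (k + 1) (lastLabel n) : ℝ) + returnTime a c k (pairFst n r)
      ≤ (2 * c (k + 1) + 1) * returnTime a c k (lastLabel n)
        + (n + 1) * (3 ^ k * returnTime a c k (pairSnd n r)) := by
  have h1 := vecMul_last_le hp.four_le (a (k + 1)) (c (k + 1)) (returnTime_le_pairSnd hp hr k)
  have h2 := returnTime_le_pairSnd hp hr k (pairFst n r)
  have h3 := returnTime_first_le_last hp k
  rw [← returnTime_succ] at h1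
  have hc0 : (0 : ℝ) ≤ c (k + 1) := Nat.cast_nonneg _
  nlinarith [mul_le_mul_of_nonneg_left h3 hc0]

theorem three_pow_le (k : ℕ) : (3 : ℝ) ^ k ≤ (3 / 4) ^ k * 25 ^ k := by
  rw [← mul_pow]; gcongr; norm_num

/-- The factor `2 c + 1` of the last label is at most half of `a + 1`, so the constant `4` becomes
`2`; the remaining labels contribute at most `1` more through `three_pow_le`. The total `3 = 4 * (3
/ 4)` reproduces the bound at the next stage. -/
theorem returnTime_last_le_pairSnd (hp : GeometricParameters n p a c) (hr : r < n / 2 - 1)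
    (k : ℕ) : (returnTime a c k (lastLabel n) : ℝ)
      ≤ 4 * (3 / 4) ^ k * returnTime a c k (pairSnd n r) ∧
      (returnTime a c (k + 1) (lastLabel n) : ℝ) + returnTime a c k (pairFst n r)
        ≤ 3 * (3 / 4) ^ k * returnTime a c (k + 1) (pairSnd n r) := by
  have hn := hp.four_le
  have key : ∀ k, (returnTime a c k (lastLabel n) : ℝ)
      ≤ 4 * (3 / 4) ^ k * returnTime a c k (pairSnd n r) →
      (returnTime a c (k + 1) (lastLabel n) : ℝ) + returnTime a c k (pairFst n r)
        ≤ 3 * (3 / 4) ^ k * returnTime a c (k + 1) (pairSnd n r) := by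
    intro k ih
    obtain ⟨hc1, hc2, hc3, hc4⟩ := hp.c_le k
    have h1 := returnTime_last_succ_le hp hr k
    have h3' : ((a (k + 1) : ℝ) + 1) * returnTime a c k (pairSnd n r)
        ≤ returnTime a c (k + 1) (pairSnd n r) := by
      exact_mod_cast (by have := le_returnTime_pairSnd (a := a) (c := c) hn hr k; omega :
        (a (k + 1) + 1) * returnTime a c k (pairSnd n r)
        ≤ returnTime a c (k + 1) (pairSnd n r))
    set x : ℝ := ((returnTime a c k (pairSnd n r) : ℕ) : ℝ)
    set y : ℝ := ((returnTime a c (k + 1) (pairSnd n r) : ℕ) : ℝ)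
    have hx : 0 ≤ x := Nat.cast_nonneg _
    have hn0 : (0 : ℝ) ≤ n := Nat.cast_nonneg _
    refine h1.trans ?_
    have e1 : (2 * c (k + 1) + 1) * (returnTime a c k (lastLabel n) : ℝ)
        ≤ 2 * (3 / 4) ^ k * ((a (k + 1) + 1) * x) := by
      calc (2 * c (k + 1) + 1) * (returnTime a c k (lastLabel n) : ℝ)
          ≤ ((a (k + 1) + 1) / 2) * (4 * (3 / 4) ^ k * x) := by
            gcongr
            linarith
        _ = _ := by ring
    have e2 : ((n : ℝ) + 1) * (3 ^ k * x) ≤ (3 / 4) ^ k * ((a (k + 1) + 1) * x) := by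
      calc ((n : ℝ) + 1) * (3 ^ k * x) ≤ (n + 1) * ((3 / 4) ^ k * 25 ^ k * x) := by
            gcongr
            exact three_pow_le k
        _ = (3 / 4) ^ k * ((n + 1) * 25 ^ k * x) := by ring
        _ ≤ (3 / 4) ^ k * ((a (k + 1) + 1) * x) := by
            gcongr
            linarith
    calc _ ≤ 3 * (3 / 4) ^ k * ((a (k + 1) + 1) * x) := by linarith
      _ ≤ _ := by gcongr
  have main : ∀ k, (returnTime a c k (lastLabel n) : ℝ)
      ≤ 4 * (3 / 4) ^ k * returnTime a c k (pairSnd n r) := by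
    intro k
    induction k with
    | zero => simp only [returnTime_zero]; norm_num
    | succ k ih =>
      have h1 := key k ih
      have h2 : (0 : ℝ) ≤ returnTime a c k (pairFst n r) := Nat.cast_nonneg _
      calc _ ≤ 3 * (3 / 4) ^ k * (returnTime a c (k + 1) (pairSnd n r) : ℝ) := by linarith
        _ = _ := by ring
  exact ⟨main k, key k (main k)⟩

theorem excess_pairSnd (hp : GeometricParameters n p a c) (hr : r < n / 2 - 1) (k : ℕ) :
    (returnTime a c (k + 1) (pairSnd n r) : ℝ) - returnTime a c k (pairSnd n r)
        * Theta n (a (k + 1)) (c (k + 1)) (pairSnd n r) (pairSnd n r)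
      ≤ 3 * (3 / 4 : ℝ) ^ k * returnTime a c (k + 1) (pairSnd n r) := by
  have hn := hp.four_le
  refine le_trans ?_ (returnTime_last_le_pairSnd hp hr k).2
  have h1 : ((a (k + 1) : ℝ) + 1)
      ≤ Theta n (a (k + 1)) (c (k + 1)) (pairSnd n r) (pairSnd n r) := by
    exact_mod_cast le_theta_pairSnd hn _ _ hr
  have h2 : (returnTime a c (k + 1) (lastLabel n) : ℝ) + returnTime a c k (pairFst n r)
        + (a (k + 1) + 1) * returnTime a c k (pairSnd n r)
      = returnTime a c (k + 1) (pairSnd n r) := by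
    exact_mod_cast le_returnTime_pairSnd (a := a) (c := c) hn hr k
  nlinarith [mul_le_mul_of_nonneg_left h1
    (Nat.cast_nonneg (α := ℝ) (returnTime a c k (pairSnd n r)))]

end PairSnd

theorem IsIndex.exists_excess (hp : GeometricParameters n p a c) {i : Fin n} (hi : IsIndex i) :
    ∃ C q : ℝ, 0 ≤ C ∧ 0 < q ∧ q < 1 ∧ ∀ k,
      (returnTime a c (k + 1) i : ℝ)
        - returnTime a c k i * Theta n (a (k + 1)) (c (k + 1)) i i
        ≤ C * q ^ k * returnTime a c (k + 1) i := by
  have hp2 : (2 : ℝ) ≤ p := by exact_mod_cast (by have := hp.lt_p; have := hp.four_le; omega)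
  rcases hi.cases hp.four_le with rfl | ⟨r, hr, rfl⟩
  · refine ⟨4 * p, 1 / p, by positivity, by positivity, ?_, excess_last hp⟩
    rw [div_lt_one (by linarith)]
    linarith
  · exact ⟨3, 3 / 4, by norm_num, by norm_num, by norm_num, excess_pairSnd hp hr⟩

theorem IsIndex.pow_mul_returnTime_le (hp : GeometricParameters n p a c) {i : Fin n}
    (hi : IsIndex i) (k : ℕ) :
    p ^ (2 * k) * returnTime a c k i ≤ returnTime a c (k + 1) i := by
  have hn := hp.four_le
  have hc := hp.pow_le k
  rcases hi.cases hn with rfl | ⟨r, hr, rfl⟩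
  · rw [returnTime_succ k, (vecMul_theta hn _ _ _).2.1]
    nlinarith [Nat.mul_le_mul_right (returnTime a c k (lastLabel n)) hc]
  · rw [← le_returnTime_pairSnd hn hr k]
    have : c (k + 1) ≤ a (k + 1) := by
      rw [hp.a_eq]
      exact Nat.le_mul_of_pos_left _ (by have := hp.lt_p; omega)
    nlinarith [Nat.mul_le_mul_right (returnTime a c k (pairSnd n r)) (hc.trans this)]

theorem vecMul_theta_one_le (hp : GeometricParameters n p a c) (k : ℕ) (t : Fin n) :
    ((Matrix.vecMul (fun _ => 1) (Theta n (a (k + 1)) (c (k + 1))) t : ℕ) : ℝ) ≤ 4 * a (k + 1) := by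
  have hn := hp.four_le
  obtain ⟨hc1, -, hc3, hc4⟩ := hp.c_le k
  have hn4 : (4 : ℝ) ≤ n := by exact_mod_cast hn
  have h1 := vecMul_theta_le hn (a (k + 1)) (c (k + 1)) (h := fun _ => 1) (H := 1)
    (fun _ => by norm_num) t
  have h2 := vecMul_last_le hn (a (k + 1)) (c (k + 1)) (h := fun _ => 1) (H := 1)
    (fun _ => by norm_num)
  push_cast at h1 h2
  linarith

theorem vecMul_theta_pos_of_last (hn : 4 ≤ n) {a c : ℕ} {h : Fin n → ℕ}
    (hz : 0 < h (lastLabel n)) (t : Fin n) : 0 < Matrix.vecMul h (Theta n a c) t := by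
  obtain ⟨h0, h1, hx, hy, hq⟩ := vecMul_theta hn a c h
  rcases label_cases hn t with rfl | rfl | ⟨r, hr, rfl⟩ | ⟨r, hr, rfl⟩ | ⟨ho, rfl⟩
  · omega
  · omega
  · rw [hx r hr]; omega
  · rw [hy r hr]; omega
  · rw [hq ho]; omega

/-- Start with height `1` at a single label. The last label is reached after one stage, or after two
by way of `pairFst` when the start is a `pairSnd`; from the last label, one more stage reaches every
label. -/
theorem three_steps_pos (hn : 4 ≤ n) {a₁ a₂ a₃ c₁ c₂ c₃ : ℕ} (ha₁ : 0 < a₁)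
    (hc₁ : 0 < c₁) (i t : Fin n) :
    0 < (Theta n a₁ c₁ * Theta n a₂ c₂ * Theta n a₃ c₃) i t := by
  have e : (Theta n a₁ c₁ * Theta n a₂ c₂ * Theta n a₃ c₃) i t
      = Matrix.vecMul (Matrix.vecMul (Matrix.vecMul (Pi.single i 1) (Theta n a₁ c₁))
        (Theta n a₂ c₂)) (Theta n a₃ c₃) t := by
    rw [Matrix.vecMul_vecMul, Matrix.vecMul_vecMul, Matrix.single_one_vecMul, Matrix.mul_assoc]
    rfl
  rw [e]
  refine vecMul_theta_pos_of_last hn ?_ t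
  obtain ⟨-, h1, hx, -, hq⟩ := vecMul_theta hn a₁ c₁ (Pi.single i 1)
  set h : Fin n → ℕ := Pi.single i 1 with hh
  set h' := Matrix.vecMul h (Theta n a₁ c₁)
  have hi : h i = 1 := by rw [hh]; exact Pi.single_eq_same i 1
  have hodd : ∀ g : Fin n → ℕ, ∀ r < n / 2 - 1, g (pairFst n r) ≤ oddSum g := by
    intro g r hr
    have := Finset.single_le_sum (f := fun r => g (pairFst n r)) (fun _ _ => Nat.zero_le _)
      (Finset.mem_range.2 hr)
    rw [oddSum]; omega
  rw [(vecMul_theta hn a₂ c₂ h').2.1]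
  have hz : 0 < h' (lastLabel n) → 0 < c₂ * (h' 0 + h' (lastLabel n)) + h' (lastLabel n)
      + oddSum h' := fun h => by omega
  rcases label_cases hn i with h0 | h0 | ⟨r, hr, h0⟩ | ⟨r, hr, h0⟩ | ⟨ho, h0⟩
  · refine hz ?_
    rw [h1, ← h0, hi]; nlinarith
  · refine hz ?_
    rw [h1, ← h0, hi]; omega
  · refine hz ?_
    have := hodd h r hr
    rw [← h0, hi] at this
    omega
  · have h2 := hx r hr
    rw [← h0, hi] at h2
    have := hodd h' r hr
    omega
  · refine hz ?_
    have : oddSum h ≥ h (penLabel n) := by rw [oddSum, if_pos ho]; omega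
    rw [← h0, hi] at this
    omega

end Growth

/-! ### Vectors that are compatible with the transition matrices -/

section RealMatrix

variable {n : ℕ}

/-- The matrix `M` with real entries. -/
def realMatrix (M : Matrix (Fin n) (Fin n) ℕ) : Matrix (Fin n) (Fin n) ℝ :=
  M.map (Nat.cast : ℕ → ℝ)

theorem realMatrix_mul (M N : Matrix (Fin n) (Fin n) ℕ) :
    realMatrix (M * N) = realMatrix M * realMatrix N :=
  Matrix.map_mul (f := Nat.castRingHom ℝ)

theorem realMatrix_one : realMatrix (1 : Matrix (Fin n) (Fin n) ℕ) = 1 := by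
  simp [realMatrix]

theorem realMatrix_mulVec (M : Matrix (Fin n) (Fin n) ℕ) (u : Fin n → ℝ) (i : Fin n) :
    Matrix.mulVec (realMatrix M) u i = ∑ t, (M i t : ℝ) * u t := rfl

theorem sum_mulVec (M : Matrix (Fin n) (Fin n) ℕ) (u : Fin n → ℝ) :
    ∑ i, Matrix.mulVec (realMatrix M) u i
      = ∑ t, ((Matrix.vecMul (fun _ => 1) M t : ℕ) : ℝ) * u t := by
  simp only [realMatrix_mulVec]
  rw [Finset.sum_comm]
  refine Finset.sum_congr rfl fun t _ => ?_
  rw [← Finset.sum_mul]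
  simp [Matrix.vecMul, dotProduct]

end RealMatrix

/-! ### Masses of the induced subintervals: decay and concentration. -/

section Compatible

variable {n : ℕ} [NeZero n] {p : ℕ} {a c : ℕ → ℕ} {v : ℕ → Fin n → ℝ}

/-- Probability vectors `v 0, v 1, …`, each the image of the next one under the transition
matrix. -/
structure CompatibleVectors (a c : ℕ → ℕ) (v : ℕ → Fin n → ℝ) : Prop where
  nonneg : ∀ k t, 0 ≤ v k t
  sum_zero : ∑ t, v 0 t = 1
  step : ∀ k, v k = Matrix.mulVec (realMatrix (Theta n (a (k + 1)) (c (k + 1)))) (v (k + 1))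

theorem CompatibleVectors.zero_eq (hv : CompatibleVectors a c v) (k : ℕ) :
    v 0 = Matrix.mulVec (realMatrix (thetaProd n a c k)) (v k) := by
  induction k with
  | zero => rw [thetaProd, realMatrix_one, Matrix.one_mulVec]
  | succ k ih => rw [ih, hv.step k, Matrix.mulVec_mulVec, thetaProd, realMatrix_mul]

/-- Kac's formula: the towers of all labels together carry the whole mass. -/
theorem CompatibleVectors.sum_returnTime (hv : CompatibleVectors a c v) (k : ℕ) :
    ∑ t, (returnTime a c k t : ℝ) * v k t = 1 := by
  rw [returnTime_eq, ← sum_mulVec, ← hv.zero_eq, hv.sum_zero]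

theorem CompatibleVectors.returnTime_mul_le (hv : CompatibleVectors a c v) (k : ℕ) (i : Fin n) :
    (returnTime a c k i : ℝ) * v k i ≤ 1 := by
  rw [← hv.sum_returnTime k]
  exact Finset.single_le_sum (f := fun t => (returnTime a c k t : ℝ) * v k t)
    (fun t _ => mul_nonneg (Nat.cast_nonneg _) (hv.nonneg k t)) (Finset.mem_univ i)

theorem CompatibleVectors.sum_le (hp : GeometricParameters n p a c) (hv : CompatibleVectors a c v)
    (k : ℕ) : ∑ t, v k t ≤ 4 * a (k + 1) * ∑ t, v (k + 1) t := by
  conv_lhs => rw [hv.step k]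
  rw [sum_mulVec, Finset.mul_sum]
  exact Finset.sum_le_sum fun t _ =>
    mul_le_mul_of_nonneg_right (vecMul_theta_one_le hp k t) (hv.nonneg _ t)

theorem CompatibleVectors.sum_pos (hp : GeometricParameters n p a c)
    (hv : CompatibleVectors a c v) (k : ℕ) : 0 < ∑ t, v k t := by
  induction k with
  | zero => rw [hv.sum_zero]; exact one_pos
  | succ k ih =>
    by_contra! h
    have h1 := hv.sum_le hp k
    have h2 : (0 : ℝ) ≤ 4 * a (k + 1) := by positivity
    nlinarith

theorem CompatibleVectors.sum_le_apply (hp : GeometricParameters n p a c)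
    (hv : CompatibleVectors a c v) (k : ℕ) (i : Fin n) : ∑ t, v (k + 3) t ≤ v k i := by
  rw [hv.step k, hv.step (k + 1), hv.step (k + 2), Matrix.mulVec_mulVec, Matrix.mulVec_mulVec,
    ← realMatrix_mul, ← realMatrix_mul, realMatrix_mulVec]
  refine Finset.sum_le_sum fun t _ => ?_
  have h : 1 ≤ (Theta n (a (k + 1)) (c (k + 1)) * Theta n (a (k + 1 + 1)) (c (k + 1 + 1))
      * Theta n (a (k + 2 + 1)) (c (k + 2 + 1))) i t :=
    three_steps_pos hp.four_le (hp.a_pos k) (hp.c_pos' k) i t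
  have h' : (1 : ℝ) ≤ ((Theta n (a (k + 1)) (c (k + 1)) * Theta n (a (k + 1 + 1)) (c (k + 1 + 1))
      * Theta n (a (k + 2 + 1)) (c (k + 2 + 1))) i t : ℕ) := by exact_mod_cast h
  exact le_mul_of_one_le_left (hv.nonneg _ t) h'

theorem CompatibleVectors.pos (hp : GeometricParameters n p a c)
    (hv : CompatibleVectors a c v) (k : ℕ) (i : Fin n) : 0 < v k i :=
  (hv.sum_pos hp (k + 3)).trans_le (hv.sum_le_apply hp k i)

/-- The entry is bounded by the total mass, this by the total mass four stages later, and
`sum_le_apply` returns from there to a single entry at stage `k + 1`. The loss is exponential in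
`k`, negligible against the decay in `log_le`. -/
theorem CompatibleVectors.apply_le (hp : GeometricParameters n p a c)
    (hv : CompatibleVectors a c v) (k : ℕ) (i : Fin n) :
    v k i ≤ (4 * a (k + 4)) ^ 4 * v (k + 1) i := by
  have hp1 : (1 : ℝ) ≤ p := by exact_mod_cast (by have := hp.lt_p; omega)
  have hmono : ∀ q ≤ k + 3, (4 * a (q + 1) : ℝ) ≤ 4 * a (k + 4) := by
    intro q hq
    rw [hp.a_formula, show k + 4 = (k + 3) + 1 by ring, hp.a_formula]
    gcongr
  have hs : ∀ q ≤ k + 3, ∑ t, v q t ≤ 4 * a (k + 4) * ∑ t, v (q + 1) t := fun q hq =>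
    (hv.sum_le hp q).trans (mul_le_mul_of_nonneg_right (hmono q hq) (hv.sum_pos hp _).le)
  set M : ℝ := 4 * a (k + 4) with hM
  have hM0 : 0 ≤ M := by positivity
  calc v k i ≤ ∑ t, v k t := Finset.single_le_sum (f := v k) (fun t _ => hv.nonneg k t)
        (Finset.mem_univ i)
    _ ≤ M * ∑ t, v (k + 1) t := hs k (by omega)
    _ ≤ M * (M * ∑ t, v (k + 2) t) := by gcongr; exact hs (k + 1) (by omega)
    _ ≤ M * (M * (M * ∑ t, v (k + 3) t)) := by gcongr; exact hs (k + 2) (by omega)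
    _ ≤ M * (M * (M * (M * ∑ t, v (k + 4) t))) := by gcongr; exact hs (k + 3) (by omega)
    _ = M ^ 4 * ∑ t, v (k + 4) t := by ring
    _ ≤ M ^ 4 * v (k + 1) i := by gcongr; exact hv.sum_le_apply hp (k + 1) i

theorem IsIndex.pow_le_returnTime (hp : GeometricParameters n p a c) {i : Fin n}
    (hi : IsIndex i) (k : ℕ) : p ^ (k * (k - 1)) ≤ returnTime a c k i := by
  induction k with
  | zero => simp [returnTime_zero]
  | succ k ih =>
    refine le_trans ?_ (hi.pow_mul_returnTime_le hp k)
    calc p ^ ((k + 1) * (k + 1 - 1)) = p ^ (2 * k) * p ^ (k * (k - 1)) := by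
          rw [← pow_add]
          congr 1
          cases k with
          | zero => rfl
          | succ k => simp only [Nat.add_sub_cancel]; ring
      _ ≤ _ := Nat.mul_le_mul_left _ ih

theorem IsIndex.returnTime_pos (hp : GeometricParameters n p a c) {i : Fin n}
    (hi : IsIndex i) (k : ℕ) : 0 < returnTime a c k i :=
  lt_of_lt_of_le (pow_pos (by have := hp.lt_p; omega) _) (hi.pow_le_returnTime hp k)

theorem CompatibleVectors.log_le (hp : GeometricParameters n p a c)
    (hv : CompatibleVectors a c v) {i : Fin n} (hi : IsIndex i) {k : ℕ} (hk : 1 ≤ k) :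
    Real.log (v k i) ≤ -((k : ℝ) * (k - 1) * Real.log p) := by
  have hp0 : (0 : ℝ) < p := by exact_mod_cast (by have := hp.lt_p; omega)
  have hb : (0 : ℝ) < returnTime a c k i := by exact_mod_cast hi.returnTime_pos hp k
  have h1 : (p : ℝ) ^ (k * (k - 1)) ≤ returnTime a c k i := by
    exact_mod_cast hi.pow_le_returnTime hp k
  have h2 := Real.log_le_log (by positivity) h1
  have h3 := Real.log_nonpos (mul_nonneg hb.le (hv.nonneg k i)) (hv.returnTime_mul_le k i)
  rw [Real.log_mul hb.ne' (hv.pos hp k i).ne'] at h3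
  rw [Real.log_pow, Nat.cast_mul, Nat.cast_sub hk, Nat.cast_one] at h2
  linarith

theorem CompatibleVectors.tendsto_zero (hp : GeometricParameters n p a c)
    (hv : CompatibleVectors a c v) {i : Fin n} (hi : IsIndex i) :
    Tendsto (fun k => v k i) atTop (𝓝 0) := by
  have hp2 : 2 ≤ p := by have := hp.lt_p; have := hp.four_le; omega
  have h1 : Tendsto (fun k : ℕ => ((1 : ℝ) / 2) ^ (k - 1)) atTop (𝓝 0) :=
    (tendsto_pow_atTop_nhds_zero_of_lt_one (by norm_num) (by norm_num)).comp
      (tendsto_sub_atTop_nat 1)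
  refine tendsto_of_tendsto_of_tendsto_of_le_of_le' tendsto_const_nhds h1
    (Eventually.of_forall fun k => hv.nonneg k i) ?_
  filter_upwards [eventually_ge_atTop 1] with k hk
  have hb : 2 ^ (k - 1) ≤ returnTime a c k i := by
    refine le_trans ?_ (hi.pow_le_returnTime hp k)
    exact (Nat.pow_le_pow_left hp2 _).trans (Nat.pow_le_pow_right (by omega)
      (Nat.le_mul_of_pos_left _ hk))
  have hb' : (2 : ℝ) ^ (k - 1) ≤ returnTime a c k i := by exact_mod_cast hb
  have h2 := hv.returnTime_mul_le k i
  rw [one_div, inv_pow, ← one_div, le_div_iff₀ (by positivity)]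
  calc v k i * 2 ^ (k - 1) ≤ v k i * returnTime a c k i := by
        gcongr
        exact hv.nonneg k i
    _ ≤ 1 := by rwa [mul_comm]

/-- After taking logarithms, the gain `(s' - s)` times a quadratic in `k` beats the loss from one
stage, which is linear in `k`. -/
theorem CompatibleVectors.eventually_rpow_le (hp : GeometricParameters n p a c)
    (hv : CompatibleVectors a c v) {i : Fin n} (hi : IsIndex i) {s s' : ℝ} (hs : 0 < s)
    (hss : s < s') : ∀ᶠ k in atTop, 2 * v k i ^ s' ≤ v (k + 1) i ^ s := by
  have hp1 : (1 : ℝ) < p := by exact_mod_cast (by have := hp.lt_p; have := hp.four_le; omega)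
  have hlp : 0 < Real.log p := Real.log_pos hp1
  have hc1 : (1 : ℝ) ≤ c 1 := by exact_mod_cast hp.c_pos
  have hlc : 0 ≤ Real.log (4 * c 1) := Real.log_nonneg (by linarith)
  set M : ℝ := Real.log 2 + 4 * s * (9 * Real.log p + Real.log (4 * c 1))
  obtain ⟨N, hN⟩ := exists_nat_gt (M / ((s' - s) * Real.log p))
  have hD : 0 < (s' - s) * Real.log p := mul_pos (by linarith) hlp
  rw [div_lt_iff₀ hD] at hN
  filter_upwards [eventually_ge_atTop (N + 1)] with k hk
  have hk1 : (1 : ℝ) ≤ k := by exact_mod_cast (by omega : 1 ≤ k)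
  have hkN : (N : ℝ) ≤ k - 1 := by
    rw [le_sub_iff_add_le]; exact_mod_cast hk
  have h0 := hv.pos hp k i
  have h1 := hv.pos hp (k + 1) i
  have ha : (0 : ℝ) < a (k + 4) := by exact_mod_cast hp.a_pos (k + 3)
  have hlog := Real.log_le_log h0 (hv.apply_le hp k i)
  have hla : Real.log (4 * a (k + 4)) = (2 * k + 7) * Real.log p + Real.log (4 * c 1) := by
    rw [show k + 4 = (k + 3) + 1 by ring, hp.a_formula,
      show (4 : ℝ) * (p ^ (2 * (k + 3) + 1) * c 1) = p ^ (2 * k + 7) * (4 * c 1) by ring,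
      Real.log_mul (by positivity) (by positivity), Real.log_pow]
    push_cast
    ring
  rw [Real.log_mul (by positivity) h1.ne', Real.log_pow, hla] at hlog
  push_cast at hlog
  have hlv := hv.log_le hp hi (k := k) (by omega)
  rw [Real.rpow_def_of_pos h0, Real.rpow_def_of_pos h1]
  calc 2 * Real.exp (Real.log (v k i) * s')
      = Real.exp (Real.log 2 + Real.log (v k i) * s') := by
        rw [Real.exp_add, Real.exp_log (by norm_num)]
    _ ≤ Real.exp (Real.log (v (k + 1) i) * s) := by
        refine Real.exp_le_exp.2 ?_
        set L := Real.log (v k i)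
        set L' := Real.log (v (k + 1) i)
        set lp := Real.log (p : ℝ)
        set lc := Real.log (4 * (c 1 : ℝ))
        have e1 : L - 4 * ((2 * k + 7) * lp + lc) ≤ L' := by linarith
        have e2 : (L - 4 * ((2 * k + 7) * lp + lc)) * s ≤ L' * s := by gcongr
        have e3 : M ≤ (s' - s) * lp * (k - 1) := by
          calc M ≤ N * ((s' - s) * lp) := hN.le
            _ ≤ (k - 1) * ((s' - s) * lp) := by gcongr
            _ = _ := by ring
        -- The `9` in `M` comes from `2 * k + 7 ≤ 9 * k` for `k ≥ 1`.
        have e4 : Real.log 2 + 4 * s * ((2 * k + 7) * lp + lc) ≤ k * M := by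
          have hl2 : 0 ≤ Real.log 2 := Real.log_nonneg (by norm_num)
          have g1 : Real.log 2 ≤ k * Real.log 2 := le_mul_of_one_le_left hl2 hk1
          have g2 : (2 * k + 7) * lp + lc ≤ k * (9 * lp + lc) := by nlinarith
          have g3 : 4 * s * ((2 * k + 7) * lp + lc) ≤ 4 * s * (k * (9 * lp + lc)) := by gcongr
          calc _ ≤ k * Real.log 2 + 4 * s * (k * (9 * lp + lc)) := add_le_add g1 g3
            _ = k * M := by ring
        have e5 : k * M ≤ (s' - s) * (k * (k - 1) * lp) := by
          calc k * M ≤ k * ((s' - s) * lp * (k - 1)) := by gcongr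
            _ = _ := by ring
        have e6 : (s' - s) * (k * (k - 1) * lp) ≤ (s' - s) * (-L) := by
          have : (0 : ℝ) ≤ s' - s := by linarith
          gcongr
          linarith
        linarith

/-! The limit of the normalized columns. -/

/-- The product of the `m` transition matrices after the first `k` ones. -/
def thetaProdFrom (n : ℕ) [NeZero n] (a c : ℕ → ℕ) (k : ℕ) : ℕ → Matrix (Fin n) (Fin n) ℕ
  | 0 => 1
  | m + 1 => thetaProdFrom n a c k m * Theta n (a (k + m + 1)) (c (k + m + 1))

theorem thetaProd_add (k m : ℕ) :
    thetaProd n a c (k + m) = thetaProd n a c k * thetaProdFrom n a c k m := by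
  induction m with
  | zero => simp [thetaProdFrom]
  | succ m ih => rw [← add_assoc, thetaProd, ih, thetaProdFrom, Matrix.mul_assoc]

/-- The right side counts the floors of the `i`-th tower of stage `k + m` that lie in the `i`-th
tower of stage `k`. Each stage loses at most the fraction of its excess, and the losses add up. -/
theorem le_returnTime_mul_thetaProdFrom {i : Fin n} {C q : ℝ} (hC : 0 ≤ C) (hq : 0 < q)
    (h : ∀ k, (returnTime a c (k + 1) i : ℝ)
        - returnTime a c k i * Theta n (a (k + 1)) (c (k + 1)) i i
        ≤ C * q ^ k * returnTime a c (k + 1) i) (k m : ℕ) :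
    (1 - ∑ r ∈ Finset.range m, C * q ^ (k + r)) * returnTime a c (k + m) i
      ≤ returnTime a c k i * (thetaProdFrom n a c k m i i : ℝ) := by
  induction m with
  | zero => simp [thetaProdFrom]
  | succ m ih =>
    have h1 := h (k + m)
    have h2 : thetaProdFrom n a c k m i i * Theta n (a (k + m + 1)) (c (k + m + 1)) i i
        ≤ thetaProdFrom n a c k (m + 1) i i := by
      rw [thetaProdFrom, Matrix.mul_apply]
      exact Finset.single_le_sum (f := fun t => thetaProdFrom n a c k m i t
        * Theta n (a (k + m + 1)) (c (k + m + 1)) t i)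
        (fun _ _ => Nat.zero_le _) (Finset.mem_univ i)
    have h2' : (thetaProdFrom n a c k m i i : ℝ) * Theta n (a (k + m + 1)) (c (k + m + 1)) i i
        ≤ thetaProdFrom n a c k (m + 1) i i := by exact_mod_cast h2
    have h3 : returnTime a c (k + m) i * Theta n (a (k + m + 1)) (c (k + m + 1)) i i
        ≤ returnTime a c (k + m + 1) i := by
      rw [returnTime_succ]
      exact Finset.single_le_sum (f := fun t => returnTime a c (k + m) t
        * Theta n (a (k + m + 1)) (c (k + m + 1)) t i)
        (fun _ _ => Nat.zero_le _) (Finset.mem_univ i)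
    have h3' : (returnTime a c (k + m) i : ℝ) * Theta n (a (k + m + 1)) (c (k + m + 1)) i i
        ≤ returnTime a c (k + m + 1) i := by exact_mod_cast h3
    rw [Finset.sum_range_succ, ← add_assoc]
    set E := ∑ r ∈ Finset.range m, C * q ^ (k + r)
    have hE : 0 ≤ E := Finset.sum_nonneg fun r _ => by positivity
    set θ : ℝ := ((Theta n (a (k + m + 1)) (c (k + m + 1)) i i : ℕ) : ℝ)
    set b : ℝ := ((returnTime a c (k + m) i : ℕ) : ℝ)
    set b' : ℝ := ((returnTime a c (k + m + 1) i : ℕ) : ℝ)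
    have hθ : 0 ≤ θ := Nat.cast_nonneg _
    have h4 := mul_le_mul_of_nonneg_right ih hθ
    have h5 := mul_le_mul_of_nonneg_left h3' hE
    have h6 := mul_le_mul_of_nonneg_left h2' (Nat.cast_nonneg (α := ℝ) (returnTime a c k i))
    linarith

/-- The hypothesis `hlim` concerns stage `0` only. Since `Θ_1 ⋯ Θ_k` is invertible, `v k` is the
limit of the columns `Θ_{k+1} ⋯ Θ_{k+m} e_i` divided by `b_{k+m,i}`, and the previous bound passes
to the limit with a geometric series. -/
theorem CompatibleVectors.le_returnTime_mul (hp : GeometricParameters n p a c)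
    (hv : CompatibleVectors a c v) {i : Fin n} (hi : IsIndex i)
    (hdet : ∀ k, (realMatrix (thetaProd n a c k)).det = 1)
    (hlim : Tendsto (fun m => normalizedColumn a c m i) atTop (𝓝 (v 0))) {C q : ℝ}
    (hC : 0 ≤ C) (hq : 0 < q) (hq1 : q < 1)
    (h : ∀ k, (returnTime a c (k + 1) i : ℝ)
        - returnTime a c k i * Theta n (a (k + 1)) (c (k + 1)) i i
        ≤ C * q ^ k * returnTime a c (k + 1) i) (k : ℕ) :
    1 - C / (1 - q) * q ^ k ≤ returnTime a c k i * v k i := by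
  set P := realMatrix (thetaProd n a c k) with hP
  have hunit : IsUnit P.det := by rw [hP, hdet]; exact isUnit_one
  have hb : ∀ m, (0 : ℝ) < returnTime a c m i := fun m => by exact_mod_cast hi.returnTime_pos hp m
  have h1 : ∀ m, Matrix.mulVec P⁻¹ (normalizedColumn a c (k + m) i)
      = fun l => (thetaProdFrom n a c k m l i : ℝ) / returnTime a c (k + m) i := by
    intro m
    have : normalizedColumn a c (k + m) i = Matrix.mulVec P
        (fun l => (thetaProdFrom n a c k m l i : ℝ) / returnTime a c (k + m) i) := by
      funext t
      rw [hP, realMatrix_mulVec, normalizedColumn, thetaProd_add, Matrix.mul_apply]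
      push_cast
      rw [Finset.sum_div]
      exact Finset.sum_congr rfl fun l _ => by ring
    rw [this, Matrix.mulVec_mulVec, Matrix.nonsing_inv_mul _ hunit, Matrix.one_mulVec]
  have h2 : Matrix.mulVec P⁻¹ (v 0) = v k := by
    rw [hv.zero_eq k, Matrix.mulVec_mulVec, Matrix.nonsing_inv_mul _ hunit, Matrix.one_mulVec]
  have hcont : Continuous fun u : Fin n → ℝ => Matrix.mulVec P⁻¹ u :=
    continuous_const.matrix_mulVec continuous_id
  have h3 : Tendsto (fun m => Matrix.mulVec P⁻¹ (normalizedColumn a c (k + m) i)) atTop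
      (𝓝 (v k)) := by
    rw [← h2]
    refine (hcont.tendsto _).comp (hlim.comp ?_)
    simpa [add_comm] using tendsto_add_atTop_nat k
  simp only [h1] at h3
  have h4 := ((tendsto_pi_nhds.1 h3) i).const_mul (returnTime a c k i : ℝ)
  refine ge_of_tendsto h4 (Eventually.of_forall fun m => ?_)
  have h5 := le_returnTime_mul_thetaProdFrom hC hq h k m
  have h6 : ∑ r ∈ Finset.range m, C * q ^ (k + r) ≤ C / (1 - q) * q ^ k := by
    have : ∑ r ∈ Finset.range m, C * q ^ (k + r) = C * q ^ k * ∑ r ∈ Finset.range m, q ^ r := by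
      rw [Finset.mul_sum]
      exact Finset.sum_congr rfl fun r _ => by ring
    rw [this]
    have hg : ∑ r ∈ Finset.range m, q ^ r ≤ (1 - q)⁻¹ := by
      rw [← tsum_geometric_of_lt_one hq.le hq1]
      exact (summable_geometric_of_lt_one hq.le hq1).sum_le_tsum _ fun r _ => by positivity
    calc C * q ^ k * ∑ r ∈ Finset.range m, q ^ r ≤ C * q ^ k * (1 - q)⁻¹ := by gcongr
      _ = _ := by ring
  rw [← mul_div_assoc, le_div_iff₀ (hb _)]
  refine le_trans ?_ h5
  gcongr

end Compatible

/-! ### The measures of the induced subintervals -/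

theorem isTower_of_towerCount {n : ℕ} {S' : IETData n} (hS' : S'.Admissible) {fl : Fin n → List ℝ}
    (h : ∀ x, S'.towerCount fl x = (Set.Ico (0 : ℝ) 1).indicator 1 x) (i : Fin n) :
    IsTower (S'.interval i) (fl i) where
  exists_Ico := ⟨_, _, lt_add_of_pos_right _ (hS'.len_pos i), rfl⟩
  count_le x := by
    rw [← h x]
    exact Finset.single_le_sum
      (f := fun t => ((fl t).map fun s => (S'.interval t).indicator (1 : ℝ → ℕ) (x - s)).sum)
      (fun _ _ => Nat.zero_le _) (Finset.mem_univ i)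

section Stage

variable {n : ℕ} [NeZero n] {p : ℕ} {a c : ℕ → ℕ} {S : IETData n}

theorem basePair_bot_perm (hn : 2 < n) : (basePair n).bot.Perm (List.finRange n) := by
  have hnd := basePair_bot_nodup hn
  refine (List.perm_ext_iff_of_nodup hnd (List.nodup_finRange n)).2 fun t => ?_
  simp only [List.mem_finRange, iff_true]
  have hcard : (basePair n).bot.toFinset.card = Fintype.card (Fin n) := by
    rw [List.toFinset_card_of_nodup hnd, Fintype.card_fin]
    simp [basePair]
  have := Finset.eq_univ_of_card _ hcard
  rw [← List.mem_toFinset, this]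
  exact Finset.mem_univ t

theorem IsGeneratedBy.admissible (hn : 2 < n) (hS : IsGeneratedBy S a c) : S.Admissible where
  top_perm := by rw [hS.pair_eq]; exact List.Perm.refl _
  bot_perm := by rw [hS.pair_eq]; exact basePair_bot_perm hn
  len_pos := hS.len_pos

theorem IsGeneratedBy.exists_floors (hn : 4 ≤ n) (hS : IsGeneratedBy S a c) (k : ℕ) :
    (stage S a c k).pair = basePair n ∧ (stage S a c k).Admissible ∧
    ∃ fl : Fin n → List ℝ,
      (∀ x, (stage S a c k).towerCount fl x = (Set.Ico (0 : ℝ) 1).indicator 1 x) ∧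
      (∀ t, (fl t).length = returnTime a c k t) ∧
      ∀ μ : Measure ℝ, IsFiniteMeasure μ → S.TransInvariant (fun _ => [0]) μ →
        (stage S a c k).TransInvariant fl μ := by
  induction k with
  | zero =>
    refine ⟨hS.pair_eq, hS.admissible (by omega), fun _ => [0], fun x => ?_, fun t => ?_,
      fun μ _ h => h⟩
    · rw [← hS.len_sum, ← IETData.sum_indicator_top (hS.admissible (by omega))]
      simp [IETData.towerCount, stage]
    · rw [returnTime_zero]; rfl
  | succ k ih =>
    obtain ⟨h1, h2, fl, h3, h4, h5⟩ := ih
    obtain ⟨g1, -, fl', g3, g4, g5⟩ := IETData.exists_floors_run _ h2 (hS.follows k) fl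
    obtain ⟨h', hc, -⟩ := track_cycle (n := n) hn (a (k + 1)) (c (k + 1)) (fun _ => 0)
    refine ⟨?_, g1, fl', fun x => (g3 x).trans (h3 x), fun t => ?_, fun μ hμ hi =>
      (g5 μ hμ (h5 μ hμ hi)).1⟩
    · rw [stage, run_pair _ (fun _ => 0), h1, hc]
    · have := congrFun g4 t
      beta_reduce at this
      rw [this, h1, ← vecMul_pathMatrix, returnTime_succ, Theta]
      simp only [h4]

theorem IsGeneratedBy.measure_step (hn : 4 ≤ n) (hS : IsGeneratedBy S a c) (k : ℕ) :
    (realMatrix (Theta n (a (k + 1)) (c (k + 1)))).det = 1 ∧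
    ∀ μ : Measure ℝ, IsFiniteMeasure μ → S.TransInvariant (fun _ => [0]) μ →
      (fun t => μ.real (subinterval S a c k t)) = Matrix.mulVec
        (realMatrix (Theta n (a (k + 1)) (c (k + 1))))
        (fun t => μ.real (subinterval S a c (k + 1) t)) := by
  obtain ⟨h1, h2, fl, h3, h4, h5⟩ := hS.exists_floors hn k
  obtain ⟨g1, g2, fl', g3, g4, g5⟩ := IETData.exists_floors_run _ h2 (hS.follows k) fl
  rw [h1] at g2 g5
  exact ⟨g2, fun μ hμ hi => (g5 μ hμ (h5 μ hμ hi)).2⟩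

theorem IsGeneratedBy.det_thetaProd (hn : 4 ≤ n) (hS : IsGeneratedBy S a c) (k : ℕ) :
    (realMatrix (thetaProd n a c k)).det = 1 := by
  induction k with
  | zero => rw [thetaProd, realMatrix_one, Matrix.det_one]
  | succ k ih => rw [thetaProd, realMatrix_mul, Matrix.det_mul, ih, (hS.measure_step hn k).1, one_mul]

theorem IsLimitMeasure.transInvariant (hn : 2 < n) (hS : IsGeneratedBy S a c) {j : Fin n}
    {μ : Measure ℝ} (hμ : IsLimitMeasure S a c j μ) : S.TransInvariant (fun _ => [0]) μ :=
  IETData.transInvariant_initial (hS.admissible hn) hS.len_sum hμ.carrier hμ.invariant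

theorem IsLimitMeasure.compatible (hp : GeometricParameters n p a c) (hS : IsGeneratedBy S a c)
    {j : Fin n} (hj : IsIndex j) {μ : Measure ℝ} (hμ : IsLimitMeasure S a c j μ) :
    CompatibleVectors a c fun k t => μ.real (subinterval S a c k t) where
  nonneg _ _ := measureReal_nonneg
  sum_zero := by
    have h1 : Tendsto (fun m => ∑ t, normalizedColumn a c m j t) atTop
        (𝓝 (∑ t, μ.real (subinterval S a c 0 t))) :=
      tendsto_finsetSum _ fun t _ => (tendsto_pi_nhds.1 hμ.limit) t
    have h2 : ∀ m, ∑ t, normalizedColumn a c m j t = 1 := by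
      intro m
      have hb : (0 : ℝ) < returnTime a c m j := by exact_mod_cast hj.returnTime_pos hp m
      simp only [normalizedColumn]
      rw [← Finset.sum_div, div_eq_one_iff_eq hb.ne', returnTime, Nat.cast_sum]
    simp only [h2] at h1
    exact tendsto_nhds_unique h1 tendsto_const_nhds
  step k := by
    have := hμ.prob
    have hn := hp.four_le
    exact (hS.measure_step hn k).2 μ inferInstance (hμ.transInvariant (by omega) hS)

end Stage
end FickIET

end

/-! ### Conclusion: the tower estimates applied to the limit measures. -/

theorem theorem2 (n : ℕ) [NeZero n] (hn : 2 < n) (p : ℕ) (hp : n + 1 ≤ p)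
    (a c : ℕ → ℕ) (hc : 0 < c 1)
    (hac : ∀ m, 1 ≤ m → c (m + 1) = p * a m ∧ p * a m = p ^ 2 * c m)
    (S : FickIET.IETData n) (hS : FickIET.IsGeneratedBy S a c)
    (i j : Fin n) (hi : FickIET.IsIndex i) (hj : FickIET.IsIndex j) (hij : i ≠ j)
    (lam_i lam_j : Measure ℝ)
    (hlam_i : FickIET.IsLimitMeasure S a c i lam_i)
    (hlam_j : FickIET.IsLimitMeasure S a c j lam_j) :
    liminf (fun k : ℕ =>
        ((Real.logb (lam_j.real (FickIET.subinterval S a c k i))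
          (lam_i.real (FickIET.subinterval S a c k i)) : ℝ) : EReal)) atTop
      ≤ FickIET.measureDim (Set.Ico (0 : ℝ) 1) (FickIET.measureDist lam_j) lam_i ∧
    FickIET.measureDim (Set.Ico (0 : ℝ) 1) (FickIET.measureDist lam_j) lam_i
      ≤ liminf (fun k : ℕ =>
          ((Real.logb (lam_j.real (FickIET.subinterval S a c k i))
            ((FickIET.returnTime a c k i : ℝ)⁻¹) : ℝ) : EReal)) atTop := by
  have hn4 : 4 ≤ n := by
    -- For `n = 3` the index set is a single point, so two distinct indices force `n ≥ 4`.
    by_contra h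
    refine hij (Fin.ext ?_)
    rcases hi with ⟨h1, h2, h3⟩ | h1 <;> rcases hj with ⟨h4, h5, h6⟩ | h4 <;> omega
  have hcc : ∀ m, 1 ≤ m → c (m + 1) = p ^ 2 * c m := fun m hm => by
    rw [(hac m hm).1, (hac m hm).2]
  have hG : FickIET.GeometricParameters n p a c :=
    { four_le := hn4
      lt_p := hp
      a_eq := fun m => by
        have h := (hac (m + 1) (by omega)).2
        rw [pow_two, mul_assoc] at h
        exact Nat.eq_of_mul_eq_mul_left (by omega) h
      c_eq := fun m => by
        induction m with
        | zero => simp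
        | succ m ih => rw [hcc (m + 1) (by omega), ih]; ring
      c_pos := hc }
  have := hlam_i.prob
  have := hlam_j.prob
  have hvi := hlam_i.compatible hG hS hi
  have hvj := hlam_j.compatible hG hS hj
  choose _ hadm fl hfl hlen htrans using fun k => hS.exists_floors hn4 k
  have hT : ∀ k, FickIET.IsTower (FickIET.subinterval S a c k i) (fl k i) :=
    fun k => FickIET.isTower_of_towerCount (hadm k) (hfl k) i
  have hμ : ∀ k, FickIET.FloorInvariant (FickIET.subinterval S a c k i) (fl k i) lam_i :=
    fun k s hs => (htrans k lam_i inferInstance (hlam_i.transInvariant hn hS)).floor_inv i s hs _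
      subset_rfl (FickIET.IETData.measurableSet_interval _ i)
  have hν : ∀ k, FickIET.FloorInvariant (FickIET.subinterval S a c k i) (fl k i) lam_j :=
    fun k s hs => (htrans k lam_j inferInstance (hlam_j.transInvariant hn hS)).floor_inv i s hs _
      subset_rfl (FickIET.IETData.measurableSet_interval _ i)
  obtain ⟨C, q, hC, hq, hq1, hexc⟩ := hi.exists_excess hG
  have hmass := hvi.le_returnTime_mul hG hi (hS.det_thetaProd hn4) hlam_i.limit hC hq hq1 hexc
  -- The tower has measure `b_{k,i} λ_i(I_i^{(k)})`, which `hmass` bounds below; the geometric error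
  -- is summable.
  have hcompl : ∀ k, lam_i (FickIET.tower (FickIET.subinterval S a c k i) (fl k i))ᶜ
      ≤ ENNReal.ofReal (C / (1 - q) * q ^ k) := by
    intro k
    have hm := FickIET.measurableSet_tower (F := fl k i) (hT k).measurableSet
    have h1 : lam_i.real (FickIET.tower (FickIET.subinterval S a c k i) (fl k i))
        = FickIET.returnTime a c k i * lam_i.real (FickIET.subinterval S a c k i) := by
      rw [measureReal_def, FickIET.measure_tower (hT k) (hμ k), ENNReal.toReal_mul,
        ENNReal.toReal_natCast, hlen k i]
      rfl
    rw [← ofReal_measureReal]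
    refine ENNReal.ofReal_le_ofReal ?_
    have h2 := measureReal_compl (μ := lam_i) hm
    rw [probReal_univ] at h2
    have h3 := hmass k
    have h4 : lam_i.real (FickIET.tower (FickIET.subinterval S a c k i) (fl k i))ᶜ
        = 1 - FickIET.returnTime a c k i * lam_i.real (FickIET.subinterval S a c k i) := by
      rw [← h1]; exact h2
    linarith
  have hsum : ∑' k, lam_i (FickIET.tower (FickIET.subinterval S a c k i) (fl k i))ᶜ ≠ ∞ := by
    refine ne_top_of_le_ne_top ?_ (ENNReal.tsum_le_tsum hcompl)
    have hs := (summable_geometric_of_lt_one hq.le hq1).mul_left (C / (1 - q))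
    rw [← ENNReal.ofReal_tsum_of_nonneg _ hs]
    · exact ENNReal.ofReal_ne_top
    · intro k
      have : 0 < 1 - q := by linarith
      positivity
  have hlim := hvj.tendsto_zero hG hi
  refine ⟨FickIET.le_measureDim_of_towers hT hμ hν hlam_i.carrier hsum
    (fun k => hvj.pos hG k i) hlim fun s s' hs hss => hvj.eventually_rpow_le hG hi hs hss, ?_⟩
  have hub := FickIET.measureDim_le_of_towers (μ := lam_i) hT (fun k h => ?_) hν
    (ENNReal.tendsto_atTop_zero_of_tsum_ne_top hsum) (fun k => hvj.pos hG k i) hlim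
  · simpa only [hlen] using hub
  · have h1 := hlen k i
    have h2 := hi.returnTime_pos hG k
    rw [h, List.length_nil] at h1
    omega
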